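/- Let $G$ be a finite graph without isolated vertices. A set $D\subseteq V(G)$ is a semitotal dominating set of $G$ if every vertex outside $D$ is adjacent to a vertex of $D$ and every vertex of $D$ is within distance $2$ of another vertex of $D$; $\gamma_{t2}(G)$ is the minimum cardinality of such a set. Subdividing an edge $uv$ $k$ times means replacing it by a path from $u$ to $v$ with $k$ new internal vertices. The semitotal domination multisubdivision number $msd_{\gamma_{t2}}(G)$ is the minimum positive integer $k$ such that $G$ has an edge whose subdivision $k$ times yields a graph with larger semitotal domination number. A labeling of a tree $T$ is a partition $S=(S_A,S_B,S_C)$ of $V(T)$ (parts may be empty); a vertex in $S_X$ has status $X$. Let $\mathscr U$ be the smallest family of labeled trees, taken up to label-preserving isomorphism, that contains the path $P_3$ whose two leaves have status $C$ and whose middle vertex has status $A$, and that is closed under the following operations. * $\mathscr P_1$: for a vertex $v$ of status $A$, add a new vertex $u$ of status $C$ and the edge $uv$. * $\mathscr P_2$: for a vertex $v$ of status $B$, add a new path $v_1v_2v_3v_4$ with statuses $B,C,A,C$ in this order, and the edge $vv_1$. * $\mathscr P_3$: for a vertex $v$ of status $C$, add a new path $v_1v_2v_3v_4v_5$ with statuses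 $B,B,C,A,C$ in this order, and the edge $vv_1$. **Theorem.** Let $T$ be a finite tree of order at least $3$. Then $msd_{\gamma_{t2}}(T)=3$ if and only if there is a labeling $S$ of $T$ with $(T,S)\in\mathscr U$. -/

import Mathlib

namespace SemitotalMsd

universe u

variable {V : Type u}

/-- `D` is a semitotal dominating set of `G`: it is a dominating set, and every vertex of `D` is
within distance `2` of another vertex of `D`. The distance is the extended one, so vertices in
different components are at distance `⊤`. -/
def IsSemitotalDominating (G : SimpleGraph V) (D : Finset V) : Prop :=
  (∀ v, v ∉ D → ∃ w ∈ D, G.Adj v w) ∧ (∀ v ∈ D, ∃ w ∈ D, w ≠ v ∧ G.edist v w ≤ 2)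

/-- The semitotal domination number: the minimum cardinality of a semitotal dominating set.
In a finite graph without isolated vertices the set of all vertices is semitotal dominating, so
the infimum is over a nonempty set there. -/
noncomputable def semitotalDominationNumber (G : SimpleGraph V) : ℕ :=
  sInf {n | ∃ D : Finset V, IsSemitotalDominating G D ∧ D.card = n}

/-- The graph obtained from `G` by subdividing the edge `uv` exactly `k` times (`k ≥ 1`): the edge
`uv` is removed and replaced by a path `u, x₀, …, xₖ₋₁, v` with `k` new vertices `xᵢ = inr i`. -/
def subdivideEdge (G : SimpleGraph V) (u v : V) (k : ℕ) : SimpleGraph (V ⊕ Fin k) where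
  Adj x y := match x, y with
    | .inl a, .inl b => G.Adj a b ∧ s(a, b) ≠ s(u, v)
    | .inl a, .inr i => (a = u ∧ i.val = 0) ∨ (a = v ∧ i.val + 1 = k)
    | .inr i, .inl a => (a = u ∧ i.val = 0) ∨ (a = v ∧ i.val + 1 = k)
    | .inr i, .inr j => i.val + 1 = j.val ∨ j.val + 1 = i.val
  symm := ⟨by
    rintro (a | i) (b | j) h
    · exact ⟨h.1.symm, by rw [Sym2.eq_swap]; exact h.2⟩
    · exact h
    · exact h
    · exact Or.symm h⟩
  loopless := ⟨by
    rintro (a | i) h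
    · exact G.loopless.irrefl a h.1
    · rcases h with h | h <;> omega⟩

/-- The semitotal domination multisubdivision number: the minimum positive integer `k` such that
there is an edge whose subdivision with `k` vertices increases the semitotal domination number
(`0` if there is no such `k`). -/
noncomputable def msd (G : SimpleGraph V) : ℕ :=
  sInf {k | 0 < k ∧ ∃ u v : V, G.Adj u v ∧
    semitotalDominationNumber G < semitotalDominationNumber (subdivideEdge G u v k)}

/-- The three possible labels (statuses) of a vertex. A labeling of `G`, that is, a partition
`(S_A, S_B, S_C)` of its vertex set (parts may be empty), is a function `V → Status`. -/
inductive Status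
  | A
  | B
  | C

/-- The graph obtained from `G` by adding a new path `v₁ v₂ … vₖ` on `k` vertices, where `vᵢ` is
`inr (i - 1)`, together with the edge `v v₁`. -/
def attachPath (G : SimpleGraph V) (v : V) (k : ℕ) : SimpleGraph (V ⊕ Fin k) where
  Adj x y := match x, y with
    | .inl a, .inl b => G.Adj a b
    | .inl a, .inr i => a = v ∧ i.val = 0
    | .inr i, .inl a => a = v ∧ i.val = 0
    | .inr i, .inr j => i.val + 1 = j.val ∨ j.val + 1 = i.val
  symm := ⟨by
    rintro (a | i) (b | j) h
    · exact G.symm.symm _ _ h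
    · exact h
    · exact h
    · exact Or.symm h⟩
  loopless := ⟨by
    rintro (a | i) h
    · exact G.loopless.irrefl a h
    · rcases h with h | h <;> omega⟩

open Status in
/-- The family of labeled trees generated from the path `P₃` with labels `C, A, C` by three
operations. Labeled trees are considered up to label-preserving isomorphism. -/
inductive FamilyU : {V : Type u} → SimpleGraph V → (V → Status) → Prop
  /-- The path `P₃`, with its two leaves labeled `C` and its support vertex labeled `A`. -/
  | base {V : Type u} {G : SimpleGraph V} {S : V → Status}
      (e : SimpleGraph.pathGraph 3 ≃g G) (hS : ∀ i, S (e i) = ![C, A, C] i) : FamilyU G S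
  /-- Attach a new vertex labeled `C` to a vertex labeled `A`. -/
  | op₁ {V : Type u} {G : SimpleGraph V} {S : V → Status} (h : FamilyU G S)
      (v : V) (hv : S v = A) : FamilyU (attachPath G v 1) (Sum.elim S ![C])
  /-- Attach a path labeled `B, C, A, C`, by its first vertex, to a vertex labeled `B`. -/
  | op₂ {V : Type u} {G : SimpleGraph V} {S : V → Status} (h : FamilyU G S)
      (v : V) (hv : S v = B) : FamilyU (attachPath G v 4) (Sum.elim S ![B, C, A, C])
  /-- Attach a path labeled `B, B, C, A, C`, by its first vertex, to a vertex labeled `C`. -/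
  | op₃ {V : Type u} {G : SimpleGraph V} {S : V → Status} (h : FamilyU G S)
      (v : V) (hv : S v = C) : FamilyU (attachPath G v 5) (Sum.elim S ![B, B, C, A, C])
  /-- The name of the vertices does not matter. -/
  | iso {V W : Type u} {G : SimpleGraph V} {H : SimpleGraph W} {S : V → Status} {R : W → Status}
      (h : FamilyU G S) (e : G ≃g H) (hR : ∀ v, R (e v) = S v) : FamilyU H R

end SemitotalMsd

/-!
Let `γ` denote the semitotal domination number. The labeled trees of the family are described by
local conditions (`IsCodeLabeling`), and these amount to the following (`IsLeafyCode`): the balls of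
radius two around the vertices of status `A` partition the tree, and every support vertex has status
`A`. One direction is an induction on the construction of the family; for the other
(`IsCodeLabeling.familyU`), the end of a longest path of a tree with such a labeling always allows
one of the operations to be undone. So the claim is that the multisubdivision number is three if and
only if there is a perfect code of radius two containing all support vertices.

Suppose that `A` is such a code. Every semitotal dominating set has at least two vertices in each
ball of radius two around a vertex of `A` (`two_le_card_inter`), so `γ ≥ 2|A|`. Conversely, root the
tree at a vertex `r` of `A`. The code together with the grandparents of its vertices other than `r`
is a dominating set with at most `2|A| - 1` vertices, in which only `r` lacks a partner. Adding one
vertex near `r` gives `γ = 2|A|`, and since `r` and the added vertex can be chosen freely, the bound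
`2|A|` survives the subdivision of any edge with one or two vertices
(`IsLeafyCode.subdivide_le_of_le_two`). Three vertices on an edge at `a ∈ A`, however, force a third
vertex near `a` (`three_le_card_inter`). This proves `IsLeafyCode.msd_eq_three`.

Now suppose that no subdivision of an edge with two vertices increases `γ`. The code has to consist
of the vertices `u` that are `deficient`: there is a dominating set containing `u` with fewer than
`γ` vertices in which only `u` lacks a partner. In every tree of order at least three, the balls of
radius two around deficient vertices are disjoint (`deficient_unique`): given witnesses for two
deficient vertices at distance at most four, exchanging them along an edge between the two vertices
yields two sets which, after adding a single vertex to one of them, are both semitotal dominating,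
and they have fewer than `2γ` vertices in total. Subdividing a pendant edge shows that its support
vertex is deficient (`support_mem_deficient`). It remains to see that every vertex is within
distance two of a deficient one (`isLeafyCode_deficient`). Root the tree at a deficient vertex and
let `b` be an uncovered vertex of greatest depth, with parent `p`. The deficient vertices below `b`
and their grandparents dominate the whole branch at `b`, with no more vertices than the covering
balls require, and they include a vertex adjacent to `b`. Subdivide `pb` twice and replace,
in a minimum semitotal dominating set, the part in the branch by this set. What is left is either a
semitotal dominating set of the tree that is too small, or shows that a neighbour of `p` is
deficient, so that `b` is covered after all (`exists_deficient_within2`).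
-/

namespace SemitotalMsd

universe u

variable {V : Type u} {G : SimpleGraph V}

/-! ### Distance at most two, and the semitotal domination number -/

/-- The vertices `x` and `y` are within distance `2`; see `edist_le_two_iff`. -/
def Within2 (G : SimpleGraph V) (x y : V) : Prop :=
  x = y ∨ G.Adj x y ∨ ∃ z, G.Adj x z ∧ G.Adj z y

lemma Within2.refl (x : V) : Within2 G x x := Or.inl rfl

lemma Within2.of_adj {x y : V} (h : G.Adj x y) : Within2 G x y := Or.inr (Or.inl h)

lemma Within2.of_adj_adj {x y z : V} (h : G.Adj x z) (h' : G.Adj z y) : Within2 G x y :=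
  Or.inr (Or.inr ⟨z, h, h'⟩)

lemma Within2.symm {x y : V} (h : Within2 G x y) : Within2 G y x := by
  rcases h with h | h | ⟨z, h, h'⟩
  · exact Or.inl h.symm
  · exact .of_adj h.symm
  · exact .of_adj_adj h'.symm h.symm

lemma edist_le_two_iff {x y : V} : G.edist x y ≤ 2 ↔ Within2 G x y := by
  constructor
  · intro h
    have hne : G.edist x y ≠ ⊤ := ne_top_of_le_ne_top (by simp) h
    obtain ⟨p, hp⟩ := SimpleGraph.exists_walk_of_edist_ne_top hne
    rw [← hp] at h
    have h2 : p.length ≤ 2 := by exact_mod_cast h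
    match p, h2 with
    | .nil, _ => exact .refl _
    | .cons h₁ .nil, _ => exact .of_adj h₁
    | .cons h₁ (.cons h₂ .nil), _ => exact .of_adj_adj h₁ h₂
    | .cons _ (.cons _ (.cons _ q)), h2 => simp at h2
  · rintro (rfl | h | ⟨z, h, h'⟩)
    · simp
    · exact (SimpleGraph.edist_le (SimpleGraph.Walk.cons h .nil)).trans (by norm_num)
    · exact (SimpleGraph.edist_le (SimpleGraph.Walk.cons h (.cons h' .nil))).trans (by norm_num)

/-- Every vertex outside `D` has a neighbour in `D`. -/
def IsDominating (G : SimpleGraph V) (D : Finset V) : Prop :=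
  ∀ v, v ∉ D → ∃ w ∈ D, G.Adj v w

lemma isSemitotalDominating_iff {D : Finset V} : IsSemitotalDominating G D ↔
    IsDominating G D ∧ ∀ v ∈ D, ∃ w ∈ D, w ≠ v ∧ Within2 G v w := by
  simp only [IsSemitotalDominating, IsDominating, edist_le_two_iff]

lemma semitotalDominationNumber_le {D : Finset V} (h : IsSemitotalDominating G D) :
    semitotalDominationNumber G ≤ D.card :=
  Nat.sInf_le ⟨D, h, rfl⟩

lemma exists_semitotalDominating_card_eq [Fintype V] (h : ∀ v, ∃ w, G.Adj v w) :
    ∃ D, IsSemitotalDominating G D ∧ D.card = semitotalDominationNumber G := by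
  apply Nat.sInf_mem (s := {n | ∃ D : Finset V, IsSemitotalDominating G D ∧ D.card = n})
  refine ⟨_, Finset.univ, isSemitotalDominating_iff.2 ⟨fun v hv => by simp at hv, fun v _ => ?_⟩,
    rfl⟩
  obtain ⟨w, hw⟩ := h v
  exact ⟨w, Finset.mem_univ _, hw.ne', .of_adj hw⟩

/-- `D` is a dominating set containing `u` in which every vertex other than `u` has another vertex
of `D` within distance `2`; the vertex `u` itself may or may not have one. -/
structure IsSemitotalExcept (G : SimpleGraph V) (D : Finset V) (u : V) : Prop where
  dominating : IsDominating G D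
  mem : u ∈ D
  partner : ∀ v ∈ D, v ≠ u → ∃ w ∈ D, w ≠ v ∧ Within2 G v w

/-- The vertices `u` for which giving up the partner condition at `u` saves at least one vertex. -/
def deficient (G : SimpleGraph V) : Set V :=
  {u | ∃ D, IsSemitotalExcept G D u ∧ D.card < semitotalDominationNumber G}

lemma IsSemitotalExcept.eq_of_within2 {D : Finset V} {u x : V} (h : IsSemitotalExcept G D u)
    (hc : D.card < semitotalDominationNumber G) (hx : x ∈ D) (hux : Within2 G u x) : x = u := by
  by_contra hne
  refine hc.not_ge (semitotalDominationNumber_le (isSemitotalDominating_iff.2 ⟨h.dominating, ?_⟩))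
  intro v hv
  by_cases hvu : v = u
  · subst hvu
    exact ⟨x, hx, hne, hux⟩
  · exact h.partner v hv hvu

/-- A ball of radius two whose centre has at least two neighbours, no two of them adjacent, contains
at least two vertices of every semitotal dominating set. -/
lemma two_le_card_inter [DecidableEq V] {D F : Finset V} (hD : IsSemitotalDominating G D)
    {a c c' : V} (hc : G.Adj a c) (hc' : G.Adj a c') (hne : c ≠ c')
    (htri : ∀ x y, G.Adj a x → G.Adj a y → ¬ G.Adj x y)
    (hF : ∀ w, Within2 G a w → w ∈ F) : 2 ≤ (D ∩ F).card := by
  obtain ⟨hdom, hpart⟩ := isSemitotalDominating_iff.1 hD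
  -- every vertex of `N[a]` is dominated from within the ball
  have key : ∀ z, z = a ∨ G.Adj a z → ∃ x ∈ D ∩ F, x = z ∨ G.Adj z x := by
    intro z hz
    by_cases hzD : z ∈ D
    · refine ⟨z, Finset.mem_inter.2 ⟨hzD, hF _ ?_⟩, Or.inl rfl⟩
      rcases hz with rfl | hz
      · exact .refl _
      · exact .of_adj hz
    · obtain ⟨x, hx, hzx⟩ := hdom z hzD
      refine ⟨x, Finset.mem_inter.2 ⟨hx, hF _ ?_⟩, Or.inr hzx⟩
      rcases hz with rfl | hz
      · exact .of_adj hzx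
      · exact .of_adj_adj hz hzx
  by_contra hlt
  have hone : ∀ x ∈ D ∩ F, ∀ y ∈ D ∩ F, x = y := by
    apply Finset.card_le_one.1; omega
  obtain ⟨x, hx, hxa⟩ := key a (Or.inl rfl)
  obtain ⟨y, hy, hyc⟩ := key c (Or.inr hc)
  obtain ⟨y', hy', hyc'⟩ := key c' (Or.inr hc')
  obtain rfl := hone x hx y hy
  obtain rfl := hone x hx y' hy'
  rcases hxa with rfl | hxa
  · obtain ⟨w, hw, hwx, hw2⟩ := hpart x (Finset.mem_inter.1 hx).1
    exact hwx (hone w (Finset.mem_inter.2 ⟨hw, hF w hw2⟩) x hx)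
  · rcases hyc with rfl | hyc
    · rcases hyc' with h | hyc'
      · exact hne h
      · exact htri _ _ hc' hxa hyc'
    · exact htri _ _ hc hxa hyc

/-! ### Trees: the neighbour closer to a root, and the two sides of an edge -/

lemma exists_adj_dist_add_one (hG : G.Connected) (r : V) {v : V} (hv : v ≠ r) :
    ∃ w, G.Adj v w ∧ G.dist r v = G.dist r w + 1 := by
  obtain ⟨p, hp⟩ := hG.exists_walk_length_eq_dist v r
  cases p with
  | nil => exact absurd rfl hv
  | @cons _ w _ h q =>
    refine ⟨w, h, ?_⟩
    rw [SimpleGraph.dist_comm, ← hp, SimpleGraph.Walk.length_cons]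
    have h1 := SimpleGraph.dist_le q
    have h2 := hG.dist_triangle (u := v) (v := w) (w := r)
    rw [SimpleGraph.dist_eq_one_iff_adj.2 h] at h2
    rw [SimpleGraph.Walk.length_cons] at hp
    rw [SimpleGraph.dist_comm]
    omega

lemma closer_unique (hG : G.IsTree) (r : V) {v w w' : V} (h : G.Adj v w) (h' : G.Adj v w')
    (hd : G.dist r v = G.dist r w + 1) (hd' : G.dist r v = G.dist r w' + 1) : w = w' := by
  obtain ⟨p, hp⟩ := hG.connected.exists_walk_length_eq_dist w r
  obtain ⟨p', hp'⟩ := hG.connected.exists_walk_length_eq_dist w' r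
  have q : (SimpleGraph.Walk.cons h p).IsPath := by
    apply SimpleGraph.Walk.isPath_of_length_eq_dist
    rw [SimpleGraph.Walk.length_cons, hp, SimpleGraph.dist_comm (u := v), hd, SimpleGraph.dist_comm]
  have q' : (SimpleGraph.Walk.cons h' p').IsPath := by
    apply SimpleGraph.Walk.isPath_of_length_eq_dist
    rw [SimpleGraph.Walk.length_cons, hp', SimpleGraph.dist_comm (u := v), hd',
      SimpleGraph.dist_comm]
  have := (hG.existsUnique_path v r).unique q q'
  injection this

lemma adj_dist (hG : G.IsTree) (r : V) {v w : V} (h : G.Adj v w) :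
    G.dist r v = G.dist r w + 1 ∨ G.dist r w = G.dist r v + 1 :=
  hG.dist_eq_dist_add_one_of_adj r h

/-- Walking on from `y` after a step away from the root, without turning back. -/
lemma dist_step (hG : G.IsTree) {r x y z : V} (hxy : G.Adj x y) (hyz : G.Adj y z) (hne : x ≠ z)
    (hd : G.dist r y = G.dist r x + 1) : G.dist r z = G.dist r y + 1 := by
  rcases adj_dist hG r hyz with h' | h'
  · exact absurd (closer_unique hG r hxy.symm hyz hd h') hne
  · exact h'

/-- The only edge of a tree between the two sides of `pq` is `pq` itself. -/
lemma eq_of_adj_across (hG : G.IsTree) {p q w w' : V} (hpq : G.Adj p q) (hw : G.Adj w w')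
    (h : G.dist w p < G.dist w q) (h' : ¬ G.dist w' p < G.dist w' q) : w = p ∧ w' = q := by
  have e1 := adj_dist hG w hpq
  have e2 := adj_dist hG w' hpq
  have t1 := hG.connected.dist_triangle (u := w) (v := w') (w := q)
  have t2 := hG.connected.dist_triangle (u := w') (v := w) (w := p)
  rw [SimpleGraph.dist_eq_one_iff_adj.2 hw] at t1
  rw [SimpleGraph.dist_eq_one_iff_adj.2 hw.symm] at t2
  by_cases h0 : w' = q
  · subst h0
    refine ⟨?_, rfl⟩
    rw [SimpleGraph.dist_self] at *
    exact (hG.connected.dist_eq_zero_iff).1 (by omega)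
  · exfalso
    obtain ⟨z, hz, hzd⟩ := exists_adj_dist_add_one hG.connected w' (v := q) (Ne.symm h0)
    have t3 := hG.connected.dist_triangle (u := w) (v := w') (w := z)
    rw [SimpleGraph.dist_eq_one_iff_adj.2 hw] at t3
    have e3 := adj_dist hG w hz
    have : p = z := closer_unique hG w hpq.symm hz (by omega) (by omega)
    subst this
    omega

lemma not_adj_of_common_neighbor (hG : G.IsTree) {a x y : V} (hx : G.Adj a x) (hy : G.Adj a y) :
    ¬ G.Adj x y := by
  intro h
  have h1 := adj_dist hG a h
  rw [SimpleGraph.dist_eq_one_iff_adj.2 hx, SimpleGraph.dist_eq_one_iff_adj.2 hy] at h1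
  omega

lemma common_neighbor_unique (hG : G.IsTree) {x y z z' : V} (hne : x ≠ y) (h1 : G.Adj x z)
    (h2 : G.Adj z y) (h1' : G.Adj x z') (h2' : G.Adj z' y) : z = z' := by
  have e := adj_dist hG x h2
  rw [SimpleGraph.dist_eq_one_iff_adj.2 h1] at e
  have hy : G.dist x y ≠ 0 := fun h => hne ((hG.connected.dist_eq_zero_iff).1 h)
  exact closer_unique hG x h2.symm h2'.symm
    (by rw [SimpleGraph.dist_eq_one_iff_adj.2 h1]; omega)
    (by rw [SimpleGraph.dist_eq_one_iff_adj.2 h1']; omega)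

lemma exists_adj_of_tree [Fintype V] (hG : G.IsTree) (hV : 3 ≤ Fintype.card V) (v : V) :
    ∃ w, G.Adj v w := by
  have : Nontrivial V := Fintype.one_lt_card_iff_nontrivial.1 (by omega)
  obtain ⟨u, hu⟩ := exists_ne v
  obtain ⟨w, hw, -⟩ := exists_adj_dist_add_one hG.connected u hu.symm
  exact ⟨w, hw⟩

/-- In a tree of order at least three, one end of every edge has another neighbour. -/
lemma exists_other_neighbor [Fintype V] (hG : G.IsTree) (hV : 3 ≤ Fintype.card V) {u v : V}
    (h : G.Adj u v) : (∃ w, G.Adj u w ∧ w ≠ v) ∨ ∃ w, G.Adj v w ∧ w ≠ u := by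
  classical
  obtain ⟨x, hx⟩ : ∃ x, x ∉ ({u, v} : Finset V) := by
    by_contra hcon
    push Not at hcon
    have h1 := Finset.card_le_card (fun y _ => hcon y : Finset.univ ⊆ ({u, v} : Finset V))
    have h2 := Finset.card_le_two (a := u) (b := v)
    rw [Finset.card_univ] at h1
    omega
  simp only [Finset.mem_insert, Finset.mem_singleton, not_or] at hx
  rcases adj_dist hG x h with hd | hd
  · obtain ⟨w, hw, hwd⟩ := exists_adj_dist_add_one hG.connected x (Ne.symm hx.2)
    exact Or.inr ⟨w, hw, by rintro rfl; omega⟩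
  · obtain ⟨w, hw, hwd⟩ := exists_adj_dist_add_one hG.connected x (Ne.symm hx.1)
    exact Or.inl ⟨w, hw, by rintro rfl; omega⟩

/-! ### Exchanging sets along an edge: deficient vertices are far apart -/

/-- `P` is the side of `p` of a bridge `pq`: the only edge leaving `P` is `pq`. -/
structure IsSide (G : SimpleGraph V) (P : Set V) (p q : V) : Prop where
  adj : G.Adj p q
  left : p ∈ P
  right : q ∉ P
  across : ∀ w w', w ∈ P → w' ∉ P → G.Adj w w' → w = p ∧ w' = q

lemma IsSide.compl {P : Set V} {p q : V} (h : IsSide G P p q) : IsSide G Pᶜ q p where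
  adj := h.adj.symm
  left := h.right
  right := fun h' => h' h.left
  across w w' hw hw' ha := by
    have := h.across w' w (not_not.1 hw') hw ha.symm
    exact ⟨this.2, this.1⟩

lemma isSide_of_adj (hG : G.IsTree) {p q : V} (h : G.Adj p q) :
    IsSide G {w | G.dist w p < G.dist w q} p q :=
  ⟨h, by simp [SimpleGraph.dist_eq_one_iff_adj.2 h], by simp,
    fun _ _ hw hw' ha => eq_of_adj_across hG h ha hw hw'⟩

lemma exists_isSide (hG : G.IsTree) {p q : V} (h : G.Adj p q) : ∃ P, IsSide G P p q :=
  ⟨_, isSide_of_adj hG h⟩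

lemma IsSide.dominated {P : Set V} {p q : V} (h : IsSide G P p q) {D : Finset V}
    (hD : IsDominating G D) {w : V} (hw : w ∈ P) (hwD : w ∉ D) :
    (∃ x ∈ D, x ∈ P ∧ G.Adj w x) ∨ (w = p ∧ q ∈ D) := by
  obtain ⟨x, hx, ha⟩ := hD w hwD
  by_cases hxP : x ∈ P
  · exact Or.inl ⟨x, hx, hxP, ha⟩
  · obtain ⟨h1, rfl⟩ := h.across w x hw hxP ha
    exact Or.inr ⟨h1, hx⟩

lemma IsSide.within2 {P : Set V} {p q : V} (h : IsSide G P p q) {w x : V} (hw : w ∈ P)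
    (hwx : Within2 G w x) : x ∈ P ∨ w = p ∨ (G.Adj w p ∧ x = q) := by
  by_cases hxP : x ∈ P
  · exact Or.inl hxP
  right
  rcases hwx with rfl | ha | ⟨z, ha, hb⟩
  · exact absurd hw hxP
  · exact Or.inl (h.across w x hw hxP ha).1
  · by_cases hz : z ∈ P
    · obtain ⟨rfl, h2⟩ := h.across z x hz hxP hb
      exact Or.inr ⟨ha, h2⟩
    · exact Or.inl (h.across w z hw hz ha).1

open Classical in
/-- The set that agrees with `D₁` on `P` and with `D₂` outside `P`. -/
noncomputable def mix (P : Set V) (D₁ D₂ : Finset V) : Finset V :=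
  D₁.filter (· ∈ P) ∪ D₂.filter (· ∉ P)

lemma mem_mix {P : Set V} {D₁ D₂ : Finset V} {x : V} :
    x ∈ mix P D₁ D₂ ↔ (x ∈ D₁ ∧ x ∈ P) ∨ (x ∈ D₂ ∧ x ∉ P) := by
  simp [mix]

lemma card_mix_add_card_mix (P : Set V) (D₁ D₂ : Finset V) :
    (mix P D₁ D₂).card + (mix P D₂ D₁).card ≤ D₁.card + D₂.card := by
  classical
  have h1 := Finset.card_filter_add_card_filter_not (s := D₁) (· ∈ P)
  have h2 := Finset.card_filter_add_card_filter_not (s := D₂) (· ∈ P)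
  have h3 := Finset.card_union_le (D₁.filter (· ∈ P)) (D₂.filter (· ∉ P))
  have h4 := Finset.card_union_le (D₂.filter (· ∈ P)) (D₁.filter (· ∉ P))
  unfold mix
  omega

lemma IsSide.mix_dominating {P : Set V} {p q : V} (h : IsSide G P p q) {D₁ D₂ M : Finset V}
    (h₁ : IsDominating G D₁) (h₂ : IsDominating G D₂) (hM : mix P D₁ D₂ ⊆ M)
    (hp : (p ∈ M ∨ ∃ x ∈ M, G.Adj p x) ∨ q ∉ D₁) (hq : (q ∈ M ∨ ∃ x ∈ M, G.Adj q x) ∨ p ∉ D₂) :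
    IsDominating G M := by
  intro w hw
  by_cases hwP : w ∈ P
  · rcases h.dominated h₁ hwP (fun hD => hw (hM (mem_mix.2 (Or.inl ⟨hD, hwP⟩)))) with
      ⟨x, hx, hxP, ha⟩ | ⟨rfl, hq'⟩
    · exact ⟨x, hM (mem_mix.2 (Or.inl ⟨hx, hxP⟩)), ha⟩
    · rcases hp with (hp | hp) | hp
      · exact absurd hp hw
      · exact hp
      · exact absurd hq' hp
  · rcases h.compl.dominated h₂ hwP (fun hD => hw (hM (mem_mix.2 (Or.inr ⟨hD, hwP⟩)))) with
      ⟨x, hx, hxP, ha⟩ | ⟨rfl, hq'⟩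
    · exact ⟨x, hM (mem_mix.2 (Or.inr ⟨hx, hxP⟩)), ha⟩
    · rcases hq with (hq | hq) | hq
      · exact absurd hq hw
      · exact hq
      · exact absurd hq' hq

section Packing

variable {u v : V} {D E : Finset V}

/-- The situation of two deficient vertices `u` and `v` with sets witnessing this. -/
structure DeficientPair (G : SimpleGraph V) (u v : V) (D E : Finset V) : Prop where
  left : IsSemitotalExcept G D u
  right : IsSemitotalExcept G E v
  card_left : D.card < semitotalDominationNumber G
  card_right : E.card < semitotalDominationNumber G
  ne : u ≠ v

lemma DeficientPair.symm (h : DeficientPair G u v D E) : DeficientPair G v u E D :=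
  ⟨h.right, h.left, h.card_right, h.card_left, h.ne.symm⟩

lemma DeficientPair.notMem_left (h : DeficientPair G u v D E) {x : V} (hx : Within2 G u x)
    (hne : x ≠ u) : x ∉ D :=
  fun hD => hne (h.left.eq_of_within2 h.card_left hD hx)

lemma DeficientPair.notMem_right (h : DeficientPair G u v D E) {x : V} (hx : Within2 G v x)
    (hne : x ≠ v) : x ∉ E :=
  h.symm.notMem_left hx hne

/-- If `M` and `N` extend the two mixtures of `D` and `E` by at most one vertex in total, they
cannot both be semitotal dominating sets. -/
lemma DeficientPair.false_of_mix (h : DeficientPair G u v D E) {P : Set V} {M N : Finset V}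
    (hM : IsSemitotalDominating G M) (hN : IsSemitotalDominating G N)
    (hc : M.card + N.card ≤ (mix P D E).card + (mix P E D).card + 1) : False := by
  have h1 := semitotalDominationNumber_le hM
  have h2 := semitotalDominationNumber_le hN
  have h3 := card_mix_add_card_mix P D E
  have h4 := h.card_left
  have h5 := h.card_right
  omega

/-- Exchange along `uv`: the mixture containing `u` and `v` is semitotal dominating as it stands,
and the other one after adding `u`. -/
lemma DeficientPair.not_adj (h : DeficientPair G u v D E) (hG : G.IsTree) (ha : G.Adj u v)
    {w : V} (hw : G.Adj u w) (hwv : w ≠ v) : False := by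
  classical
  obtain ⟨P, hP⟩ := exists_isSide hG ha
  have huE : u ∉ E := h.notMem_right (.of_adj ha.symm) h.ne
  have hvD : v ∉ D := h.notMem_left (.of_adj ha) h.ne.symm
  have huP : u ∈ P := hP.left
  have hvP : v ∉ P := hP.right
  have huM : u ∈ mix P D E := mem_mix.2 (Or.inl ⟨h.left.mem, huP⟩)
  have hvM : v ∈ mix P D E := mem_mix.2 (Or.inr ⟨h.right.mem, hvP⟩)
  refine h.false_of_mix (P := P) (M := mix P D E) (N := insert u (mix P E D))
    (isSemitotalDominating_iff.2 ⟨?_, ?_⟩) (isSemitotalDominating_iff.2 ⟨?_, ?_⟩) ?_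
  · exact hP.mix_dominating h.left.dominating h.right.dominating subset_rfl (Or.inr hvD)
      (Or.inr huE)
  · intro x hx
    rcases mem_mix.1 hx with ⟨hxD, hxP⟩ | ⟨hxE, hxP⟩
    · by_cases hxu : x = u
      · subst hxu
        exact ⟨v, hvM, h.ne.symm, .of_adj ha⟩
      · obtain ⟨y, hy, hyx, hxy⟩ := h.left.partner x hxD hxu
        rcases hP.within2 hxP hxy with hyP | rfl | ⟨-, rfl⟩
        · exact ⟨y, mem_mix.2 (Or.inl ⟨hy, hyP⟩), hyx, hxy⟩
        · exact absurd rfl hxu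
        · exact absurd hy hvD
    · by_cases hxv : x = v
      · subst hxv
        exact ⟨u, huM, h.ne, .of_adj ha.symm⟩
      · obtain ⟨y, hy, hyx, hxy⟩ := h.right.partner x hxE hxv
        rcases hP.compl.within2 hxP hxy with hyP | rfl | ⟨-, rfl⟩
        · exact ⟨y, mem_mix.2 (Or.inr ⟨hy, hyP⟩), hyx, hxy⟩
        · exact absurd rfl hxv
        · exact absurd hy huE
  · exact hP.mix_dominating h.right.dominating h.left.dominating (Finset.subset_insert _ _)
      (Or.inl (Or.inl (Finset.mem_insert_self _ _)))
      (Or.inl (Or.inr ⟨u, Finset.mem_insert_self _ _, ha.symm⟩))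
  · intro x hx
    rcases Finset.mem_insert.1 hx with rfl | hx
    · -- the second neighbour `w` has its own dominator in `E`, at distance two from `u`
      have hwP : w ∈ P := by
        by_contra hwP
        exact hwv (hP.across _ _ huP hwP hw).2
      have hwE : w ∉ E := h.notMem_right (.of_adj_adj ha.symm hw) hwv
      obtain ⟨z, hz, hwz⟩ := h.right.dominating w hwE
      have hzx : z ≠ x := fun h' => huE (h' ▸ hz)
      have hzP : z ∈ P := by
        by_contra hzP
        exact hw.ne' (hP.across _ _ hwP hzP hwz).1
      exact ⟨z, Finset.mem_insert_of_mem (mem_mix.2 (Or.inl ⟨hz, hzP⟩)), hzx, .of_adj_adj hw hwz⟩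
    · rcases mem_mix.1 hx with ⟨hxE, hxP⟩ | ⟨hxD, hxP⟩
      · obtain ⟨y, hy, hyx, hxy⟩ := h.right.partner x hxE (fun h' => hvP (h' ▸ hxP))
        rcases hP.within2 hxP hxy with hyP | rfl | ⟨hxu, rfl⟩
        · exact ⟨y, Finset.mem_insert_of_mem (mem_mix.2 (Or.inl ⟨hy, hyP⟩)), hyx, hxy⟩
        · exact absurd hxE huE
        · exact absurd hxE (h.notMem_right (.of_adj_adj ha.symm hxu.symm) hyx.symm)
      · obtain ⟨y, hy, hyx, hxy⟩ := h.left.partner x hxD (fun h' => hxP (h' ▸ huP))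
        rcases hP.compl.within2 hxP hxy with hyP | rfl | ⟨hxu, rfl⟩
        · exact ⟨y, Finset.mem_insert_of_mem (mem_mix.2 (Or.inr ⟨hy, hyP⟩)), hyx, hxy⟩
        · exact absurd hxD hvD
        · exact absurd hxD (h.notMem_left (.of_adj_adj ha hxu.symm) hyx.symm)
  · have := Finset.card_insert_le u (mix P E D)
    omega

/-- Exchange along `um`: the mixture containing `u` and `v` is semitotal dominating as it stands,
and the other one after adding `m`. -/
lemma DeficientPair.not_dist_two (h : DeficientPair G u v D E) (hG : G.IsTree) {m : V}
    (ha : G.Adj u m) (hb : G.Adj m v) : False := by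
  classical
  obtain ⟨P, hP⟩ := exists_isSide hG ha
  have hE : ∀ x, Within2 G v x → x ≠ v → x ∉ E := fun x => h.notMem_right
  have hD : ∀ x, Within2 G u x → x ≠ u → x ∉ D := fun x => h.notMem_left
  have huE : u ∉ E := hE u (.of_adj_adj hb.symm ha.symm) h.ne
  have hmE : m ∉ E := hE m (.of_adj hb.symm) hb.ne
  have hmD : m ∉ D := hD m (.of_adj ha) ha.ne'
  have huP : u ∈ P := hP.left
  have hmP : m ∉ P := hP.right
  have hvP : v ∉ P := fun hv => h.ne (hP.across _ _ hv hmP hb.symm).1.symm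
  have huM : u ∈ mix P D E := mem_mix.2 (Or.inl ⟨h.left.mem, huP⟩)
  have hvM : v ∈ mix P D E := mem_mix.2 (Or.inr ⟨h.right.mem, hvP⟩)
  refine h.false_of_mix (P := P) (M := mix P D E) (N := insert m (mix P E D))
    (isSemitotalDominating_iff.2 ⟨?_, ?_⟩) (isSemitotalDominating_iff.2 ⟨?_, ?_⟩) ?_
  · exact hP.mix_dominating h.left.dominating h.right.dominating subset_rfl (Or.inr hmD)
      (Or.inr huE)
  · intro x hx
    rcases mem_mix.1 hx with ⟨hxD, hxP⟩ | ⟨hxE, hxP⟩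
    · by_cases hxu : x = u
      · subst hxu
        exact ⟨v, hvM, h.ne.symm, .of_adj_adj ha hb⟩
      · obtain ⟨y, hy, hyx, hxy⟩ := h.left.partner x hxD hxu
        rcases hP.within2 hxP hxy with hyP | rfl | ⟨-, rfl⟩
        · exact ⟨y, mem_mix.2 (Or.inl ⟨hy, hyP⟩), hyx, hxy⟩
        · exact absurd rfl hxu
        · exact absurd hy hmD
    · by_cases hxv : x = v
      · subst hxv
        exact ⟨u, huM, h.ne, .of_adj_adj hb.symm ha.symm⟩
      · obtain ⟨y, hy, hyx, hxy⟩ := h.right.partner x hxE hxv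
        rcases hP.compl.within2 hxP hxy with hyP | rfl | ⟨-, rfl⟩
        · exact ⟨y, mem_mix.2 (Or.inr ⟨hy, hyP⟩), hyx, hxy⟩
        · exact absurd hxE hmE
        · exact absurd hy huE
  · exact hP.mix_dominating h.right.dominating h.left.dominating (Finset.subset_insert _ _)
      (Or.inr hmE) (Or.inl (Or.inl (Finset.mem_insert_self _ _)))
  · intro x hx
    rcases Finset.mem_insert.1 hx with rfl | hx
    · -- the dominator of `u` in `E` is a partner of the middle vertex
      obtain ⟨z, hz, huz⟩ := h.right.dominating u huE
      have hzx : z ≠ x := fun h' => hmE (h' ▸ hz)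
      have hzP : z ∈ P := by
        by_contra hzP
        exact hzx (hP.across _ _ huP hzP huz).2
      exact ⟨z, Finset.mem_insert_of_mem (mem_mix.2 (Or.inl ⟨hz, hzP⟩)), hzx,
        .of_adj_adj ha.symm huz⟩
    · rcases mem_mix.1 hx with ⟨hxE, hxP⟩ | ⟨hxD, hxP⟩
      · obtain ⟨y, hy, hyx, hxy⟩ := h.right.partner x hxE (fun h' => hvP (h' ▸ hxP))
        rcases hP.within2 hxP hxy with hyP | rfl | ⟨hxu, rfl⟩
        · exact ⟨y, Finset.mem_insert_of_mem (mem_mix.2 (Or.inl ⟨hy, hyP⟩)), hyx, hxy⟩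
        · exact absurd hxE huE
        · exact absurd hy hmE
      · obtain ⟨y, hy, hyx, hxy⟩ := h.left.partner x hxD (fun h' => hxP (h' ▸ huP))
        rcases hP.compl.within2 hxP hxy with hyP | rfl | ⟨hxm, rfl⟩
        · exact ⟨y, Finset.mem_insert_of_mem (mem_mix.2 (Or.inr ⟨hy, hyP⟩)), hyx, hxy⟩
        · exact absurd hxD hmD
        · exact absurd hxD (hD x (.of_adj_adj ha hxm.symm) hyx.symm)
  · have := Finset.card_insert_le m (mix P E D)
    omega

/-- Exchange along `mn`, whose ends belong to neither set: the mixture containing `u` and `v`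
becomes semitotal dominating after adding `m`, and the other one is so as it stands. -/
lemma DeficientPair.not_dist_three (h : DeficientPair G u v D E) (hG : G.IsTree) {m n : V}
    (ha : G.Adj u m) (hb : G.Adj m n) (hc : G.Adj n v) (hun : u ≠ n) (hvm : v ≠ m) : False := by
  classical
  obtain ⟨P, hP⟩ := exists_isSide hG hb
  have hE : ∀ x, Within2 G v x → x ≠ v → x ∉ E := fun x => h.notMem_right
  have hD : ∀ x, Within2 G u x → x ≠ u → x ∉ D := fun x => h.notMem_left
  have hmE : m ∉ E := hE m (.of_adj_adj hc.symm hb.symm) hvm.symm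
  have hnE : n ∉ E := hE n (.of_adj hc.symm) hc.ne
  have hmD : m ∉ D := hD m (.of_adj ha) ha.ne'
  have hnD : n ∉ D := hD n (.of_adj_adj ha hb) hun.symm
  have hmP : m ∈ P := hP.left
  have hnP : n ∉ P := hP.right
  have huP : u ∈ P := by
    by_contra huP
    exact hun (hP.across _ _ hmP huP ha.symm).2
  have hvP : v ∉ P := fun hv => hvm (hP.across _ _ hv hnP hc.symm).1
  have huM : u ∈ mix P D E := mem_mix.2 (Or.inl ⟨h.left.mem, huP⟩)
  refine h.false_of_mix (P := P) (M := insert m (mix P D E)) (N := mix P E D)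
    (isSemitotalDominating_iff.2 ⟨?_, ?_⟩) (isSemitotalDominating_iff.2 ⟨?_, ?_⟩) ?_
  · exact hP.mix_dominating h.left.dominating h.right.dominating (Finset.subset_insert _ _)
      (Or.inr hnD) (Or.inr hmE)
  · intro x hx
    rcases Finset.mem_insert.1 hx with rfl | hx
    · exact ⟨u, Finset.mem_insert_of_mem huM, ha.ne, .of_adj ha.symm⟩
    rcases mem_mix.1 hx with ⟨hxD, hxP⟩ | ⟨hxE, hxP⟩
    · by_cases hxu : x = u
      · subst hxu
        exact ⟨m, Finset.mem_insert_self _ _, ha.ne', .of_adj ha⟩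
      · obtain ⟨y, hy, hyx, hxy⟩ := h.left.partner x hxD hxu
        rcases hP.within2 hxP hxy with hyP | rfl | ⟨-, rfl⟩
        · exact ⟨y, Finset.mem_insert_of_mem (mem_mix.2 (Or.inl ⟨hy, hyP⟩)), hyx, hxy⟩
        · exact absurd hxD hmD
        · exact absurd hy hnD
    · by_cases hxv : x = v
      · subst hxv
        exact ⟨m, Finset.mem_insert_self _ _, hvm.symm, .of_adj_adj hc.symm hb.symm⟩
      · obtain ⟨y, hy, hyx, hxy⟩ := h.right.partner x hxE hxv
        rcases hP.compl.within2 hxP hxy with hyP | rfl | ⟨-, rfl⟩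
        · exact ⟨y, Finset.mem_insert_of_mem (mem_mix.2 (Or.inr ⟨hy, hyP⟩)), hyx, hxy⟩
        · exact absurd hxE hnE
        · exact absurd hy hmE
  · exact hP.mix_dominating h.right.dominating h.left.dominating subset_rfl
      (Or.inr hnE) (Or.inr hmD)
  · intro x hx
    rcases mem_mix.1 hx with ⟨hxE, hxP⟩ | ⟨hxD, hxP⟩
    · obtain ⟨y, hy, hyx, hxy⟩ := h.right.partner x hxE (fun h' => hvP (h' ▸ hxP))
      rcases hP.within2 hxP hxy with hyP | rfl | ⟨hxu, rfl⟩
      · exact ⟨y, mem_mix.2 (Or.inl ⟨hy, hyP⟩), hyx, hxy⟩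
      · exact absurd hxE hmE
      · exact absurd hy hnE
    · obtain ⟨y, hy, hyx, hxy⟩ := h.left.partner x hxD (fun h' => hxP (h' ▸ huP))
      rcases hP.compl.within2 hxP hxy with hyP | rfl | ⟨hxm, rfl⟩
      · exact ⟨y, mem_mix.2 (Or.inr ⟨hy, hyP⟩), hyx, hxy⟩
      · exact absurd hxD hnD
      · exact absurd hy hmD
  · have := Finset.card_insert_le m (mix P D E)
    omega

/-- Exchange along `mc`: the mixture containing `u` and `v` becomes semitotal dominating after
adding `c`. In the other one only `m` can lose its partner, and then `n` replaces it. -/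
lemma DeficientPair.not_dist_four_aux (h : DeficientPair G u v D E) (hG : G.IsTree) {m c n : V}
    (ha : G.Adj u m) (hb : G.Adj m c) (hc : G.Adj c n) (hd : G.Adj n v) (huc : u ≠ c)
    (hmn : m ≠ n) (hvc : v ≠ c) (hor : n ∈ D ∨ m ∉ E) : False := by
  classical
  obtain ⟨P, hP⟩ := exists_isSide hG hb
  have hE : ∀ x, Within2 G v x → x ≠ v → x ∉ E := fun x => h.notMem_right
  have hD : ∀ x, Within2 G u x → x ≠ u → x ∉ D := fun x => h.notMem_left
  have hcE : c ∉ E := hE c (.of_adj_adj hd.symm hc.symm) hvc.symm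
  have hmD : m ∉ D := hD m (.of_adj ha) ha.ne'
  have hcD : c ∉ D := hD c (.of_adj_adj ha hb) huc.symm
  have hmP : m ∈ P := hP.left
  have hcP : c ∉ P := hP.right
  have huP : u ∈ P := by
    by_contra huP
    exact huc (hP.across _ _ hmP huP ha.symm).2
  have hnP : n ∉ P := fun hn => hmn (hP.across _ _ hn hcP hc.symm).1.symm
  have hvP : v ∉ P := fun hv => hc.ne' (hP.across _ _ hv hnP hd.symm).2
  have huM : u ∈ mix P D E := mem_mix.2 (Or.inl ⟨h.left.mem, huP⟩)
  refine h.false_of_mix (P := P) (M := insert c (mix P D E)) (N := mix P E D)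
    (isSemitotalDominating_iff.2 ⟨?_, ?_⟩) (isSemitotalDominating_iff.2 ⟨?_, ?_⟩) ?_
  · exact hP.mix_dominating h.left.dominating h.right.dominating (Finset.subset_insert _ _)
      (Or.inr hcD) (Or.inl (Or.inl (Finset.mem_insert_self _ _)))
  · intro x hx
    rcases Finset.mem_insert.1 hx with rfl | hx
    · exact ⟨u, Finset.mem_insert_of_mem huM, huc, .of_adj_adj hb.symm ha.symm⟩
    rcases mem_mix.1 hx with ⟨hxD, hxP⟩ | ⟨hxE, hxP⟩
    · by_cases hxu : x = u
      · subst hxu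
        exact ⟨c, Finset.mem_insert_self _ _, huc.symm, .of_adj_adj ha hb⟩
      · obtain ⟨y, hy, hyx, hxy⟩ := h.left.partner x hxD hxu
        rcases hP.within2 hxP hxy with hyP | rfl | ⟨-, rfl⟩
        · exact ⟨y, Finset.mem_insert_of_mem (mem_mix.2 (Or.inl ⟨hy, hyP⟩)), hyx, hxy⟩
        · exact absurd hxD hmD
        · exact absurd hy hcD
    · by_cases hxv : x = v
      · subst hxv
        exact ⟨c, Finset.mem_insert_self _ _, hvc.symm, .of_adj_adj hd.symm hc.symm⟩
      · obtain ⟨y, hy, hyx, hxy⟩ := h.right.partner x hxE hxv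
        rcases hP.compl.within2 hxP hxy with hyP | rfl | ⟨hxc, rfl⟩
        · exact ⟨y, Finset.mem_insert_of_mem (mem_mix.2 (Or.inr ⟨hy, hyP⟩)), hyx, hxy⟩
        · exact absurd hxE hcE
        · exact ⟨c, Finset.mem_insert_self _ _, hxc.ne', .of_adj hxc⟩
  · exact hP.mix_dominating h.right.dominating h.left.dominating subset_rfl
      (Or.inr hcE) (Or.inr hmD)
  · intro x hx
    rcases mem_mix.1 hx with ⟨hxE, hxP⟩ | ⟨hxD, hxP⟩
    · obtain ⟨y, hy, hyx, hxy⟩ := h.right.partner x hxE (fun h' => hvP (h' ▸ hxP))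
      rcases hP.within2 hxP hxy with hyP | rfl | ⟨hxu, rfl⟩
      · exact ⟨y, mem_mix.2 (Or.inl ⟨hy, hyP⟩), hyx, hxy⟩
      · rcases hor with hnD | hxE'
        · exact ⟨n, mem_mix.2 (Or.inr ⟨hnD, hnP⟩), hmn.symm, .of_adj_adj hb hc⟩
        · exact absurd hxE hxE'
      · exact absurd hy hcE
    · obtain ⟨y, hy, hyx, hxy⟩ := h.left.partner x hxD (fun h' => hxP (h' ▸ huP))
      rcases hP.compl.within2 hxP hxy with hyP | rfl | ⟨hxm, rfl⟩
      · exact ⟨y, mem_mix.2 (Or.inr ⟨hy, hyP⟩), hyx, hxy⟩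
      · exact absurd hxD hcD
      · exact absurd hy hmD
  · have := Finset.card_insert_le c (mix P D E)
    omega

/-- If `n ∉ D`, the exchange is made along the edge `nc` instead. -/
lemma DeficientPair.not_dist_four (h : DeficientPair G u v D E) (hG : G.IsTree) {m c n : V}
    (ha : G.Adj u m) (hb : G.Adj m c) (hc : G.Adj c n) (hd : G.Adj n v) (huc : u ≠ c)
    (hmn : m ≠ n) (hvc : v ≠ c) : False := by
  by_cases hn : n ∈ D
  · exact h.not_dist_four_aux hG ha hb hc hd huc hmn hvc (Or.inl hn)
  · exact h.symm.not_dist_four_aux hG hd.symm hc.symm hb.symm ha.symm hvc hmn.symm huc (Or.inr hn)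

/-- In a tree of order at least three, the balls of radius two around the deficient vertices are
pairwise disjoint. -/
theorem deficient_unique [Fintype V] (hG : G.IsTree) (hV : 3 ≤ Fintype.card V) {u v x : V}
    (hu : u ∈ deficient G) (hv : v ∈ deficient G) (hux : Within2 G u x) (hvx : Within2 G v x) :
    u = v := by
  by_contra hne
  obtain ⟨D, hD, hDc⟩ := hu
  obtain ⟨E, hE, hEc⟩ := hv
  have h : DeficientPair G u v D E := ⟨hD, hE, hDc, hEc, hne⟩
  have h1 : ¬ G.Adj u v := fun ha => by
    rcases exists_other_neighbor hG hV ha with ⟨w, hw, hwv⟩ | ⟨w, hw, hwu⟩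
    · exact h.not_adj hG ha hw hwv
    · exact h.symm.not_adj hG ha.symm hw hwu
  have h2 : ∀ m, G.Adj u m → ¬ G.Adj m v := fun m ha hb => h.not_dist_two hG ha hb
  have h3 : ∀ m n, G.Adj u m → G.Adj m n → ¬ G.Adj n v := fun m n ha hb hc =>
    h.not_dist_three hG ha hb hc (by rintro rfl; exact h1 hc) (by rintro rfl; exact h1 ha)
  rcases hux with rfl | ha | ⟨m, ha, hb⟩
  · rcases hvx with rfl | hc | ⟨n, hd, hc⟩
    · exact hne rfl
    · exact h1 hc.symm
    · exact h2 n hc.symm hd.symm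
  · rcases hvx with rfl | hc | ⟨n, hd, hc⟩
    · exact h1 ha
    · exact h2 x ha hc.symm
    · exact h3 x n ha hc.symm hd.symm
  · rcases hvx with rfl | hc | ⟨n, hd, hc⟩
    · exact h2 m ha hb
    · exact h3 m x ha hb hc.symm
    · refine h.not_dist_four hG ha hb hc.symm hd.symm ?_ ?_ ?_
      · rintro rfl; exact h2 n hc.symm hd.symm
      · rintro rfl; exact h2 m ha hd.symm
      · rintro rfl; exact h2 m ha hb

end Packing

/-! ### Perfect codes of radius two, and grandparents -/

/-- The balls of radius two around the vertices of `A` are disjoint, and every support vertex (the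
neighbour of a leaf) is in `A`. -/
structure IsLeafyPacking (G : SimpleGraph V) (A : Set V) : Prop where
  unique : ∀ a ∈ A, ∀ a' ∈ A, ∀ v, Within2 G a v → Within2 G a' v → a = a'
  leaf : ∀ l s, G.Adj l s → (∀ w, G.Adj l w → w = s) → s ∈ A

/-- A perfect code of radius two that contains every support vertex. -/
structure IsLeafyCode (G : SimpleGraph V) (A : Set V) : Prop extends IsLeafyPacking G A where
  cover : ∀ v, ∃ a ∈ A, Within2 G a v

lemma IsLeafyPacking.exists_two_neighbors {A : Set V} (hA : IsLeafyPacking G A)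
    (hdeg : ∀ v, ∃ w, G.Adj v w) {a : V} (ha : a ∈ A) :
    ∃ c c', G.Adj a c ∧ G.Adj a c' ∧ c ≠ c' := by
  obtain ⟨c, hc⟩ := hdeg a
  by_contra hcon
  push Not at hcon
  have hcA : c ∈ A := hA.leaf a c hc fun w hw => hcon w c hw hc
  exact hc.ne (hA.unique a ha c hcA a (.refl _) (.of_adj hc.symm))

open Classical in
/-- The neighbour of `v` closer to the root `r` (and `v` itself if there is none). -/
noncomputable def parent (G : SimpleGraph V) (r v : V) : V :=
  if h : ∃ w, G.Adj v w ∧ G.dist r v = G.dist r w + 1 then h.choose else v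

lemma parent_eq (hG : G.IsTree) {r v w : V} (h : G.Adj v w) (hd : G.dist r v = G.dist r w + 1) :
    parent G r v = w := by
  have hex : ∃ w, G.Adj v w ∧ G.dist r v = G.dist r w + 1 := ⟨w, h, hd⟩
  rw [parent, dif_pos hex]
  exact closer_unique hG r hex.choose_spec.1 h hex.choose_spec.2 hd

lemma parent_spec (hG : G.IsTree) {r v : V} (hv : v ≠ r) :
    G.Adj v (parent G r v) ∧ G.dist r v = G.dist r (parent G r v) + 1 := by
  obtain ⟨w, h, hd⟩ := exists_adj_dist_add_one hG.connected r hv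
  rw [parent_eq hG h hd]
  exact ⟨h, hd⟩

/-- The parent of the parent of `v`, with respect to the root `r`. -/
noncomputable abbrev grandparent (G : SimpleGraph V) (r v : V) : V := parent G r (parent G r v)

lemma IsLeafyPacking.grandparent_spec {A : Set V} (hA : IsLeafyPacking G A) (hG : G.IsTree)
    {r a : V} (hr : r ∈ A) (ha : a ∈ A) (har : a ≠ r) :
    G.Adj a (parent G r a) ∧ G.Adj (parent G r a) (grandparent G r a) ∧
      G.dist r a = G.dist r (parent G r a) + 1 ∧
      G.dist r (parent G r a) = G.dist r (grandparent G r a) + 1 := by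
  obtain ⟨h1, h2⟩ := parent_spec hG har
  have hne : parent G r a ≠ r := fun h =>
    har (hA.unique a ha r hr a (.refl _) (.of_adj (h ▸ h1.symm)))
  obtain ⟨h3, h4⟩ := parent_spec hG hne
  exact ⟨h1, h3, h2, h4⟩

/-- A vertex `w` not dominated by the packing `A`, all of whose children are covered, is the
grandparent of a vertex of `A`, or has a child that is. Indeed `w` is not a leaf, so it has a child,
and the vertex of `A` covering that child lies below `w`, at distance two or three from it. -/
lemma IsLeafyPacking.exists_grandparent {A : Set V} (hA : IsLeafyPacking G A) (hG : G.IsTree)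
    {r w : V} (hr : r ∈ A) (hwA : w ∉ A) (hw : ∀ a ∈ A, ¬ G.Adj w a)
    (hcov : ∀ x, G.Adj w x → G.dist r x = G.dist r w + 1 → ∃ a ∈ A, Within2 G a x) :
    (∃ a ∈ A, a ≠ r ∧ grandparent G r a = w) ∨
      ∃ x, G.Adj w x ∧ G.dist r x = G.dist r w + 1 ∧ ∃ a ∈ A, a ≠ r ∧ grandparent G r a = x := by
  have hwr : w ≠ r := fun h => hwA (h ▸ hr)
  have ne_root : ∀ {a : V} {n : ℕ}, G.dist r a = n + 1 → a ≠ r := by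
    rintro a n h rfl
    rw [SimpleGraph.dist_self] at h
    omega
  obtain ⟨q, hq, hqd⟩ := exists_adj_dist_add_one hG.connected r hwr
  obtain ⟨x, hx, hxd⟩ : ∃ x, G.Adj w x ∧ G.dist r x = G.dist r w + 1 := by
    by_contra hcon
    push Not at hcon
    refine hw q (hA.leaf w q hq fun y hy => ?_) hq
    rcases adj_dist hG r hy with h | h
    · exact closer_unique hG r hy hq h hqd
    · exact absurd h (hcon y hy)
  obtain ⟨a, ha, hax⟩ := hcov x hx hxd
  rcases hax with rfl | hax | ⟨z, haz, hzx⟩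
  · exact absurd hx (hw a ha)
  · left
    have had : G.dist r a = G.dist r x + 1 := by
      rcases adj_dist hG r hax with h | h
      · exact h
      · exact absurd (closer_unique hG r hax.symm hx.symm h hxd ▸ ha) hwA
    refine ⟨a, ha, ne_root had, ?_⟩
    rw [grandparent, parent_eq hG hax had, parent_eq hG hx.symm hxd]
  · right
    have hzw : z ≠ w := by
      rintro rfl
      exact hw a ha haz.symm
    have hzd : G.dist r z = G.dist r x + 1 := by
      rcases adj_dist hG r hzx with h | h
      · exact h
      · exact absurd (closer_unique hG r hzx.symm hx.symm h hxd) hzw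
    have had : G.dist r a = G.dist r z + 1 := by
      rcases adj_dist hG r haz with h | h
      · exact h
      · have hax := closer_unique hG r haz.symm hzx h hzd
        exact absurd hx (hw x (hax ▸ ha))
    refine ⟨x, hx, hxd, a, ha, ne_root had, ?_⟩
    rw [grandparent, parent_eq hG haz had, parent_eq hG hzx hzd]

open Classical in
/-- The set `S` together with the grandparents of its vertices other than the root `r`. -/
noncomputable def withGrandparents (G : SimpleGraph V) (r : V) (S : Finset V) : Finset V :=
  S ∪ (S.erase r).image (grandparent G r)

lemma mem_withGrandparents {r x : V} {S : Finset V} : x ∈ withGrandparents G r S ↔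
    x ∈ S ∨ ∃ a ∈ S, a ≠ r ∧ grandparent G r a = x := by
  simp [withGrandparents, and_assoc, and_left_comm]

lemma card_withGrandparents_le (r : V) (S : Finset V) :
    (withGrandparents G r S).card ≤ 2 * S.card := by
  classical
  have h1 := Finset.card_union_le S ((S.erase r).image (grandparent G r))
  have h2 := Finset.card_image_le (s := S.erase r) (f := grandparent G r)
  have h3 := Finset.card_erase_le (s := S) (a := r)
  rw [withGrandparents]
  omega

lemma card_withGrandparents_lt {r : V} {S : Finset V} (hr : r ∈ S) :
    (withGrandparents G r S).card < 2 * S.card := by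
  classical
  have h1 := Finset.card_union_le S ((S.erase r).image (grandparent G r))
  have h2 := Finset.card_image_le (s := S.erase r) (f := grandparent G r)
  have h3 := Finset.card_erase_lt_of_mem hr
  rw [withGrandparents]
  omega

lemma IsLeafyPacking.partner_withGrandparents {A : Set V} (hA : IsLeafyPacking G A)
    (hG : G.IsTree) {r : V} (hr : r ∈ A) {S : Finset V} (hS : ∀ a ∈ S, a ∈ A) {v : V}
    (hv : v ∈ withGrandparents G r S) (hvr : v ≠ r) :
    ∃ w ∈ withGrandparents G r S, w ≠ v ∧ ∃ c, G.Adj v c ∧ G.Adj c w ∧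
      ((c = parent G r v ∧ v ∈ A) ∨ (c = parent G r w ∧ w ∈ A ∧ w ≠ r)) := by
  have key : ∀ a ∈ S, a ≠ r → G.Adj a (parent G r a) ∧
      G.Adj (parent G r a) (grandparent G r a) ∧ a ≠ grandparent G r a := by
    intro a ha har
    obtain ⟨h1, h2, h3, h4⟩ := hA.grandparent_spec hG hr (hS a ha) har
    refine ⟨h1, h2, fun h => ?_⟩
    rw [← h] at h4
    omega
  rcases mem_withGrandparents.1 hv with hvS | ⟨a, ha, har, rfl⟩
  · obtain ⟨h1, h2, h3⟩ := key v hvS hvr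
    exact ⟨_, mem_withGrandparents.2 (Or.inr ⟨v, hvS, hvr, rfl⟩), h3.symm, _, h1, h2,
      Or.inl ⟨rfl, hS v hvS⟩⟩
  · obtain ⟨h1, h2, h3⟩ := key a ha har
    exact ⟨a, mem_withGrandparents.2 (Or.inl ha), h3, _, h2.symm, h1.symm,
      Or.inr ⟨rfl, hS a ha, har⟩⟩

/-! ### Balls as a lower bound -/

open Classical in
/-- The ball of radius two around `a`. -/
noncomputable def ball2 [Fintype V] (G : SimpleGraph V) (a : V) : Finset V :=
  Finset.univ.filter (Within2 G a)

lemma mem_ball2 [Fintype V] {a w : V} : w ∈ ball2 G a ↔ Within2 G a w := by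
  simp [ball2]

/-- A semitotal dominating set has at least two vertices in each of a family of disjoint sets that
contain balls of radius two. -/
lemma two_mul_card_le [DecidableEq V] {ι : Type*} {S : Finset ι} {c : ι → V} {F : ι → Finset V}
    {D : Finset V} (hD : IsSemitotalDominating G D)
    (hF : ∀ a ∈ S, ∀ w, Within2 G (c a) w → w ∈ F a)
    (hdisj : ∀ a ∈ S, ∀ b ∈ S, a ≠ b → Disjoint (F a) (F b))
    (hnbr : ∀ a ∈ S, ∃ x y, G.Adj (c a) x ∧ G.Adj (c a) y ∧ x ≠ y)
    (htri : ∀ a ∈ S, ∀ x y, G.Adj (c a) x → G.Adj (c a) y → ¬ G.Adj x y) :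
    2 * S.card ≤ (D ∩ S.biUnion F).card := by
  rw [Finset.inter_biUnion, Finset.card_biUnion, mul_comm, ← smul_eq_mul]
  · refine Finset.card_nsmul_le_sum _ _ _ fun a ha => ?_
    obtain ⟨x, y, hx, hy, hxy⟩ := hnbr a ha
    exact two_le_card_inter hD hx hy hxy (htri a ha) (hF a ha)
  · intro a ha b hb hab
    exact (hdisj a ha b hb hab).mono Finset.inter_subset_right Finset.inter_subset_right

/-! ### Subdividing an edge -/

section Subdivide

variable {p q : V} {k : ℕ}

lemma subdivide_adj_of_ne {z : V} {y : V ⊕ Fin k} (hp : z ≠ p) (hq : z ≠ q)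
    (h : (subdivideEdge G p q k).Adj (.inl z) y) : ∃ w, y = .inl w ∧ G.Adj z w := by
  rcases y with w | i
  · exact ⟨w, rfl, h.1⟩
  · rcases h with ⟨h, -⟩ | ⟨h, -⟩
    · exact absurd h hp
    · exact absurd h hq

lemma subdivide_adj_inl {z w : V} (h : G.Adj z w) (hne : s(z, w) ≠ s(p, q)) :
    (subdivideEdge G p q k).Adj (.inl z) (.inl w) := ⟨h, hne⟩

lemma subdivide_within2 {a : V} {y : V ⊕ Fin k} (ha : a ≠ p ∧ a ≠ q)
    (hc : ∀ c, G.Adj a c → c ≠ p ∧ c ≠ q) (h : Within2 (subdivideEdge G p q k) (.inl a) y) :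
    ∃ w, y = .inl w ∧ Within2 G a w := by
  rcases h with rfl | h | ⟨z, h, h'⟩
  · exact ⟨a, rfl, .refl _⟩
  · obtain ⟨w, rfl, hw⟩ := subdivide_adj_of_ne ha.1 ha.2 h
    exact ⟨w, rfl, .of_adj hw⟩
  · obtain ⟨z, rfl, hz⟩ := subdivide_adj_of_ne ha.1 ha.2 h
    obtain ⟨w, rfl, hw⟩ := subdivide_adj_of_ne (hc z hz).1 (hc z hz).2 h'
    exact ⟨w, rfl, .of_adj_adj hz hw⟩

lemma exists_adj_subdivide (hdeg : ∀ v, ∃ w, G.Adj v w) (hk : 0 < k) (x : V ⊕ Fin k) :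
    ∃ y, (subdivideEdge G p q k).Adj x y := by
  rcases x with v | i
  · by_cases hp : v = p
    · exact ⟨.inr ⟨0, hk⟩, Or.inl ⟨hp, rfl⟩⟩
    by_cases hq : v = q
    · exact ⟨.inr ⟨k - 1, by omega⟩, Or.inr ⟨hq, by simp; omega⟩⟩
    obtain ⟨w, hw⟩ := hdeg v
    refine ⟨.inl w, hw, fun h => ?_⟩
    have hv := h ▸ Sym2.mem_mk_left v w
    rcases Sym2.mem_iff.1 hv with h | h
    · exact hp h
    · exact hq h
  · by_cases hi : i.val = 0
    · exact ⟨.inl p, Or.inl ⟨rfl, hi⟩⟩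
    · exact ⟨.inr ⟨i.val - 1, by omega⟩, Or.inr (by simp; omega)⟩

/-- The balls around the vertices of a packing that are not near the subdivided edge keep forcing
two vertices each. -/
lemma two_mul_card_le_subdivide [Fintype V] [DecidableEq V] (hG : G.IsTree)
    (hdeg : ∀ v, ∃ w, G.Adj v w) {A : Set V} (hA : IsLeafyPacking G A) {S : Finset V}
    (hS : ∀ a ∈ S, a ∈ A ∧ (a ≠ p ∧ a ≠ q) ∧ ∀ c, G.Adj a c → c ≠ p ∧ c ≠ q)
    {D : Finset (V ⊕ Fin k)} (hD : IsSemitotalDominating (subdivideEdge G p q k) D) :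
    2 * S.card ≤ (D ∩ S.biUnion fun a => (ball2 G a).map .inl).card := by
  refine two_mul_card_le (c := Sum.inl) hD ?_ ?_ ?_ ?_
  · intro a ha w hw
    obtain ⟨w, rfl, h⟩ := subdivide_within2 (hS a ha).2.1 (hS a ha).2.2 hw
    exact Finset.mem_map_of_mem _ (mem_ball2.2 h)
  · intro a ha b hb hab
    rw [Finset.disjoint_map, Finset.disjoint_left]
    intro w hw hw'
    exact hab (hA.unique a (hS a ha).1 b (hS b hb).1 w (mem_ball2.1 hw) (mem_ball2.1 hw'))
  · intro a ha
    obtain ⟨c, c', hc, hc', hne⟩ := hA.exists_two_neighbors hdeg (hS a ha).1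
    have : ∀ w, s(a, w) ≠ s(p, q) := by
      intro w h
      rcases Sym2.mem_iff.1 (h ▸ Sym2.mem_mk_left a w) with h | h
      · exact (hS a ha).2.1.1 h
      · exact (hS a ha).2.1.2 h
    exact ⟨.inl c, .inl c', ⟨hc, this c⟩, ⟨hc', this c'⟩, fun h => hne (Sum.inl_injective h)⟩
  · intro a ha x y hx hy hxy
    obtain ⟨x, rfl, hx'⟩ := subdivide_adj_of_ne (hS a ha).2.1.1 (hS a ha).2.1.2 hx
    obtain ⟨y, rfl, hy'⟩ := subdivide_adj_of_ne (hS a ha).2.1.1 (hS a ha).2.1.2 hy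
    exact not_adj_of_common_neighbor hG hx' hy' hxy.1

end Subdivide

/-! ### If no double subdivision helps, the deficient vertices form a perfect code -/

section Trace

variable {P : Set V} {p b : V} {D : Finset (V ⊕ Fin 2)}

open Classical in
/-- The vertices of `P` that lie in the set `D` of vertices of a subdivided graph. -/
noncomputable def trace [Fintype V] {k : ℕ} (P : Set V) (D : Finset (V ⊕ Fin k)) : Finset V :=
  Finset.univ.filter fun v => v ∈ P ∧ .inl v ∈ D

lemma mem_trace [Fintype V] {k : ℕ} {D : Finset (V ⊕ Fin k)} {v : V} :
    v ∈ trace P D ↔ v ∈ P ∧ .inl v ∈ D := by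
  simp [trace]

lemma card_trace_add_card_le [Fintype V] {k : ℕ} {D R : Finset (V ⊕ Fin k)} (hR : R ⊆ D)
    (hRP : ∀ v, .inl v ∈ R → v ∉ P) : (trace P D).card + R.card ≤ D.card := by
  classical
  rw [← Finset.card_map (Function.Embedding.inl : V ↪ V ⊕ Fin k), ← Finset.card_union_of_disjoint]
  · refine Finset.card_le_card (Finset.union_subset (fun x hx => ?_) hR)
    obtain ⟨v, hv, rfl⟩ := Finset.mem_map.1 hx
    exact (mem_trace.1 hv).2
  · rw [Finset.disjoint_left]
    intro x hx hxR
    obtain ⟨v, hv, rfl⟩ := Finset.mem_map.1 hx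
    exact hRP v hxR (mem_trace.1 hv).1

lemma IsSide.subdivide_adj (hP : IsSide G P p b) {v : V} (hv : v ∈ P) {y : V ⊕ Fin 2}
    (h : (subdivideEdge G p b 2).Adj (.inl v) y) :
    (∃ w ∈ P, y = .inl w ∧ G.Adj v w) ∨ (v = p ∧ y = .inr 0) := by
  rcases y with w | i
  · left
    refine ⟨w, ?_, rfl, h.1⟩
    by_contra hw
    obtain ⟨rfl, rfl⟩ := hP.across v w hv hw h.1
    exact h.2 rfl
  · right
    rcases h with ⟨h, hi⟩ | ⟨rfl, -⟩
    · exact ⟨h, congrArg _ (Fin.ext hi)⟩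
    · exact absurd hv hP.right

lemma IsSide.subdivide_within2 (hP : IsSide G P p b) {v : V} (hv : v ∈ P) {y : V ⊕ Fin 2}
    (h : Within2 (subdivideEdge G p b 2) (.inl v) y) :
    (∃ w ∈ P, y = .inl w ∧ Within2 G v w) ∨ v = p ∨ (G.Adj v p ∧ y = .inr 0) := by
  rcases h with rfl | h | ⟨z, h, h'⟩
  · exact Or.inl ⟨v, hv, rfl, .refl _⟩
  · rcases hP.subdivide_adj hv h with ⟨w, hw, rfl, ha⟩ | ⟨h1, -⟩
    · exact Or.inl ⟨w, hw, rfl, .of_adj ha⟩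
    · exact Or.inr (Or.inl h1)
  · rcases hP.subdivide_adj hv h with ⟨z, hz, rfl, ha⟩ | ⟨h1, -⟩
    · rcases hP.subdivide_adj hz h' with ⟨w, hw, rfl, hb⟩ | ⟨rfl, h2⟩
      · exact Or.inl ⟨w, hw, rfl, .of_adj_adj ha hb⟩
      · exact Or.inr (Or.inr ⟨ha, h2⟩)
    · exact Or.inr (Or.inl h1)

/-- The second subdivision vertex is dominated. -/
lemma exists_mem_near (hD : IsSemitotalDominating (subdivideEdge G p b 2) D) :
    .inr 0 ∈ D ∨ .inr 1 ∈ D ∨ .inl b ∈ D := by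
  by_cases h : .inr 1 ∈ D
  · exact Or.inr (Or.inl h)
  obtain ⟨y, hy, ha⟩ := (isSemitotalDominating_iff.1 hD).1 _ h
  rcases y with w | i
  · rcases ha with ⟨-, ha⟩ | ⟨rfl, -⟩
    · simp at ha
    · exact Or.inr (Or.inr hy)
  · rcases ha with ha | ha
    · simp at ha
      omega
    · have hi : i = 0 := Fin.ext (by simpa using ha)
      exact Or.inl (hi ▸ hy)

/-- The first subdivision vertex is dominated. -/
lemma exists_mem_near' (hD : IsSemitotalDominating (subdivideEdge G p b 2) D)
    (hp : .inl p ∉ D) : .inr 0 ∈ D ∨ .inr 1 ∈ D := by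
  by_cases h : .inr 0 ∈ D
  · exact Or.inl h
  obtain ⟨y, hy, ha⟩ := (isSemitotalDominating_iff.1 hD).1 _ h
  rcases y with w | i
  · rcases ha with ⟨rfl, -⟩ | ⟨-, ha⟩
    · exact absurd hy hp
    · simp at ha
  · rcases ha with ha | ha
    · have hi : i = 1 := Fin.ext (by simpa using ha.symm)
      exact Or.inr (hi ▸ hy)
    · simp at ha

variable [Fintype V] [DecidableEq V]

/-- Contracting a double subdivision, keeping `D` on the side of `p`, adding `p`, and replacing `D`
by `K` on the side of `b`. -/
lemma IsSide.except_insert (hP : IsSide G P p b)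
    (hD : IsSemitotalDominating (subdivideEdge G p b 2) D) {K : Finset V}
    (hK : ∀ v ∉ P, v ∉ K → ∃ w ∈ insert p K, G.Adj v w)
    (hKp : ∀ v ∈ K, ∃ w ∈ K, w ≠ v ∧ Within2 G v w) :
    IsSemitotalExcept G (insert p (trace P D ∪ K)) p := by
  obtain ⟨hdom, hpart⟩ := isSemitotalDominating_iff.1 hD
  refine ⟨fun v hv => ?_, Finset.mem_insert_self _ _, fun v hv hvp => ?_⟩
  · simp only [Finset.mem_insert, Finset.mem_union, not_or] at hv
    by_cases hvP : v ∈ P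
    · obtain ⟨y, hy, ha⟩ := hdom (.inl v) fun h => hv.2.1 (mem_trace.2 ⟨hvP, h⟩)
      rcases hP.subdivide_adj hvP ha with ⟨w, hw, rfl, hvw⟩ | ⟨rfl, -⟩
      · exact ⟨w, by simp [mem_trace, hw, hy], hvw⟩
      · exact absurd rfl hv.1
    · obtain ⟨w, hw, ha⟩ := hK v hvP hv.2.2
      refine ⟨w, ?_, ha⟩
      simp only [Finset.mem_insert, Finset.mem_union] at hw ⊢
      tauto
  · simp only [Finset.mem_insert, Finset.mem_union] at hv
    rcases hv with hv | hv | hv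
    · exact absurd hv hvp
    · obtain ⟨hvP, hvD⟩ := mem_trace.1 hv
      obtain ⟨y, hy, hyv, hvy⟩ := hpart _ hvD
      rcases hP.subdivide_within2 hvP hvy with ⟨w, hw, rfl, h⟩ | h | ⟨h, -⟩
      · exact ⟨w, by simp [mem_trace, hw, hy], fun h => hyv (h ▸ rfl), h⟩
      · exact absurd h hvp
      · exact ⟨p, Finset.mem_insert_self _ _, h.ne', .of_adj h⟩
    · obtain ⟨w, hw, hwv, h⟩ := hKp v hv
      exact ⟨w, by simp [hw], hwv, h⟩

/-- Contracting a double subdivision, keeping `D` on the side of `p` and replacing it by `K` on the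
side of `b`. If `D` contains the new neighbour of `p`, then a neighbour `u` of `p` in `D` is needed
to dominate `p` and to serve as a partner. -/
lemma IsSide.union_dominating (hP : IsSide G P p b)
    (hD : IsSemitotalDominating (subdivideEdge G p b 2) D) {K : Finset V} {u : V}
    (hp : .inl p ∉ D) (hu : .inr 0 ∈ D → u ∈ trace P D ∧ G.Adj p u)
    (hK : ∀ v ∉ P, v ∉ K → ∃ w ∈ K, G.Adj v w)
    (hKp : ∀ v ∈ K, ∃ w ∈ K, w ≠ v ∧ Within2 G v w) :
    IsDominating G (trace P D ∪ K) ∧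
      ∀ v ∈ trace P D ∪ K, v ≠ u → ∃ w ∈ trace P D ∪ K, w ≠ v ∧ Within2 G v w := by
  obtain ⟨hdom, hpart⟩ := isSemitotalDominating_iff.1 hD
  refine ⟨fun v hv => ?_, fun v hv hvu => ?_⟩
  · simp only [Finset.mem_union, not_or] at hv
    by_cases hvP : v ∈ P
    · obtain ⟨y, hy, ha⟩ := hdom (.inl v) fun h => hv.1 (mem_trace.2 ⟨hvP, h⟩)
      rcases hP.subdivide_adj hvP ha with ⟨w, hw, rfl, hvw⟩ | ⟨rfl, rfl⟩
      · exact ⟨w, by simp [mem_trace, hw, hy], hvw⟩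
      · exact ⟨u, Finset.mem_union_left _ (hu hy).1, (hu hy).2⟩
    · obtain ⟨w, hw, ha⟩ := hK v hvP hv.2
      exact ⟨w, Finset.mem_union_right _ hw, ha⟩
  · simp only [Finset.mem_union] at hv
    rcases hv with hv | hv
    · obtain ⟨hvP, hvD⟩ := mem_trace.1 hv
      obtain ⟨y, hy, hyv, hvy⟩ := hpart _ hvD
      rcases hP.subdivide_within2 hvP hvy with ⟨w, hw, rfl, h⟩ | rfl | ⟨h, rfl⟩
      · exact ⟨w, by simp [mem_trace, hw, hy], fun h => hyv (h ▸ rfl), h⟩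
      · exact absurd hvD hp
      · exact ⟨u, Finset.mem_union_left _ (hu hy).1, Ne.symm hvu, .of_adj_adj h (hu hy).2⟩
    · obtain ⟨w, hw, hwv, h⟩ := hKp v hv
      exact ⟨w, Finset.mem_union_right _ hw, hwv, h⟩

end Trace

section FiniteTree

variable [Fintype V]

/-- If subdividing a pendant edge twice does not help, its support vertex is deficient. -/
lemma support_mem_deficient (hdeg : ∀ v, ∃ w, G.Adj v w) {l s : V} (hls : G.Adj l s)
    (hl : ∀ w, G.Adj l w → w = s)
    (hsub : semitotalDominationNumber (subdivideEdge G s l 2) ≤ semitotalDominationNumber G) :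
    s ∈ deficient G := by
  classical
  obtain ⟨D, hD, hDc⟩ := exists_semitotalDominating_card_eq
    (exists_adj_subdivide (p := s) (q := l) (k := 2) hdeg (by norm_num))
  have hP : IsSide G {l}ᶜ s l := by
    refine ⟨hls.symm, hls.ne', by simp, fun w w' hw hw' ha => ?_⟩
    have h : w' = l := by simpa using hw'
    subst h
    exact ⟨hl w ha.symm, rfl⟩
  have hex := hP.except_insert hD (K := ∅)
    (fun v hv _ => ⟨s, by simp, by
      have h : v = l := by simpa using hv
      exact h ▸ hls⟩) (by simp)
  refine ⟨_, hex, ?_⟩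
  rw [Finset.union_empty]
  by_cases hs : s ∈ trace {l}ᶜ D
  · rw [Finset.insert_eq_of_mem hs]
    have : ∃ y ∈ D, ∀ v, .inl v = y → v = l := by
      rcases exists_mem_near hD with h | h | h
      · exact ⟨_, h, by simp⟩
      · exact ⟨_, h, by simp⟩
      · exact ⟨_, h, by simp⟩
    obtain ⟨y, hy, hyv⟩ := this
    have := card_trace_add_card_le (P := {l}ᶜ) (Finset.singleton_subset_iff.2 hy)
      (fun v hv => by simpa using hyv v (Finset.mem_singleton.1 hv))
    rw [Finset.card_singleton] at this
    omega
  · have hsD : .inl s ∉ D := fun h => hs (mem_trace.2 ⟨hP.left, h⟩)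
    -- two of the three vertices beyond `s` are in `D`
    have : ∃ y ∈ D, ∃ z ∈ D, y ≠ z ∧ ∀ v, .inl v = y ∨ .inl v = z → v = l := by
      obtain ⟨hdom, hpart⟩ := isSemitotalDominating_iff.1 hD
      have hleaf : ∀ y, (subdivideEdge G s l 2).Adj (.inl l) y → y = .inr 1 := by
        rintro (w | i) ha
        · obtain rfl := hl w ha.1
          exact absurd Sym2.eq_swap ha.2
        · rcases ha with ⟨h, -⟩ | ⟨-, h⟩
          · exact absurd h hls.ne
          · exact congrArg _ (Fin.ext (by simpa using h))
      by_cases h1 : .inr 1 ∈ D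
      · obtain ⟨y, hy, hy1, h⟩ := hpart _ h1
        refine ⟨_, h1, y, hy, hy1.symm, fun v hv => ?_⟩
        rcases hv with hv | rfl
        · simp at hv
        rcases h with h | (⟨-, h⟩ | ⟨h, -⟩) | ⟨z, h, h'⟩
        · simp at h
        · simp at h
        · exact h
        · rcases z with z | i
          · rcases h with ⟨-, h⟩ | ⟨rfl, -⟩
            · simp at h
            · have := hleaf _ h'
              simp at this
          · rcases h with h | h
            · simp at h
              omega
            · rcases h' with ⟨rfl, -⟩ | ⟨rfl, -⟩
              · exact absurd hy hsD
              · rfl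
      · have h0 : .inr 0 ∈ D := (exists_mem_near' hD hsD).resolve_right h1
        have hlD : .inl l ∈ D := by
          by_contra hlD
          obtain ⟨y, hy, ha⟩ := hdom _ hlD
          exact h1 (hleaf y ha ▸ hy)
        exact ⟨_, h0, _, hlD, by simp, by simp⟩
    obtain ⟨y, hy, z, hz, hyz, hv⟩ := this
    have := card_trace_add_card_le (P := {l}ᶜ) (R := {y, z}) (D := D)
      (by simp [Finset.insert_subset_iff, hy, hz])
      (fun v hv' => by simpa using hv v (by simpa using hv'))
    rw [Finset.card_pair hyz] at this
    have := Finset.card_insert_le s (trace {l}ᶜ D)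
    omega

/-- A vertex `b` all of whose proper descendants are covered by the deficient vertices is covered
itself, unless subdividing the edge from `b` to its parent twice increases the semitotal domination
number. -/
lemma exists_deficient_within2 (hG : G.IsTree) (hV : 3 ≤ Fintype.card V)
    (hA : IsLeafyPacking G (deficient G)) {r b : V} (hr : r ∈ deficient G) (hbr : b ≠ r)
    (hcov : ∀ w, G.dist r b < G.dist r w → ∃ a ∈ deficient G, Within2 G a w)
    (hsub : ∀ p, G.Adj p b →
      semitotalDominationNumber (subdivideEdge G p b 2) ≤ semitotalDominationNumber G) :
    ∃ a ∈ deficient G, Within2 G a b := by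
  classical
  by_contra hb
  push Not at hb
  have hdeg := exists_adj_of_tree hG hV
  obtain ⟨p, hbp, hbpd⟩ := exists_adj_dist_add_one hG.connected r hbr
  have hP := isSide_of_adj hG hbp.symm
  have hrP : r ∈ {w | G.dist w p < G.dist w b} := by
    rw [Set.mem_ofPred_eq]
    omega
  set P : Set V := {w | G.dist w p < G.dist w b} with hPdef
  clear_value P
  -- the vertices outside `P` are the descendants of `b`
  have hdesc : ∀ n, ∀ w, G.dist r w = n → w ∉ P → w = b ∨ G.dist r b < G.dist r w := by
    intro n
    induction n with
    | zero =>
      intro w hw hwP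
      rw [hG.connected.dist_eq_zero_iff] at hw
      exact absurd (hw ▸ hrP) hwP
    | succ n ih =>
      intro w hw hwP
      have hwr : w ≠ r := fun h => hwP (h ▸ hrP)
      obtain ⟨q, hq, hqd⟩ := exists_adj_dist_add_one hG.connected r hwr
      by_cases hqP : q ∈ P
      · exact Or.inl (hP.across q w hqP hwP hq.symm).2
      · rcases ih q (by omega) hqP with rfl | h
        · exact Or.inr (by omega)
        · exact Or.inr (by omega)
  have hchild : ∀ w x, w ∉ P → G.Adj w x → G.dist r x = G.dist r w + 1 → x ∉ P := by
    intro w x hw hwx hd hx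
    obtain ⟨rfl, rfl⟩ := hP.across x w hx hw hwx.symm
    omega
  have hball : ∀ a ∈ deficient G, a ∉ P → ∀ w, Within2 G a w → w ∉ P ∧ w ≠ b := by
    intro a ha haP w hw
    refine ⟨?_, fun h => hb a ha (h ▸ hw)⟩
    rcases hP.compl.within2 haP hw with h | rfl | ⟨h, -⟩
    · exact h
    · exact absurd (.refl _) (hb a ha)
    · exact absurd (.of_adj h) (hb a ha)
  set S : Finset V := Finset.univ.filter fun a => a ∈ deficient G ∧ a ∉ P with hSdef
  have hS : ∀ {a}, a ∈ S ↔ a ∈ deficient G ∧ a ∉ P := by simp [hSdef]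
  set K := withGrandparents G r S with hKdef
  have hKcard : K.card ≤ 2 * S.card := card_withGrandparents_le r S
  -- if the grandparent of `a` is a descendant of `b`, so is `a`
  have hgp : ∀ a ∈ deficient G, a ≠ r → grandparent G r a ∉ P → grandparent G r a ∈ K := by
    intro a ha har h
    obtain ⟨h1, h2, h3, h4⟩ := hA.grandparent_spec hG hr ha har
    have haP := hchild _ _ (hchild _ _ h h2.symm h4) h1.symm h3
    exact mem_withGrandparents.2 (Or.inr ⟨a, hS.2 ⟨ha, haP⟩, har, rfl⟩)
  have hex : ∀ w ∉ P, w ∉ deficient G → (∀ a ∈ deficient G, ¬ G.Adj w a) →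
      w ∈ K ∨ ∃ x ∈ K, x ∉ P ∧ G.Adj w x := by
    intro w hw hwA hwa
    have hcov' : ∀ x, G.Adj w x → G.dist r x = G.dist r w + 1 →
        ∃ a ∈ deficient G, Within2 G a x := by
      intro x _ hd
      refine hcov x ?_
      rcases hdesc _ w rfl hw with rfl | h
      · omega
      · omega
    rcases hA.exists_grandparent hG hr hwA hwa hcov' with
      ⟨a, ha, har, rfl⟩ | ⟨x, hx, hxd, a, ha, har, rfl⟩
    · exact Or.inl (hgp a ha har hw)
    · have hxP := hchild _ _ hw hx hxd
      exact Or.inr ⟨_, hgp a ha har hxP, hxP, hx⟩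
  have hKdom : ∀ v ∉ P, v ∉ K → ∃ w ∈ K, G.Adj v w := by
    intro v hv hvK
    have hvA : v ∉ deficient G := fun h => hvK (mem_withGrandparents.2 (Or.inl (hS.2 ⟨h, hv⟩)))
    by_cases hva : ∃ a ∈ deficient G, G.Adj v a
    · obtain ⟨a, ha, hva⟩ := hva
      refine ⟨a, mem_withGrandparents.2 (Or.inl (hS.2 ⟨ha, fun haP => ?_⟩)), hva⟩
      obtain ⟨-, rfl⟩ := hP.across a v haP hv hva.symm
      exact hb a ha (.of_adj hva.symm)
    · push Not at hva
      rcases hex v hv hvA hva with h | ⟨x, hx, -, h⟩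
      · exact absurd h hvK
      · exact ⟨x, hx, h⟩
  have hrS : r ∉ S := fun h => (hS.1 h).2 hrP
  have hKP : ∀ v ∈ K, v ∉ P := by
    intro v hv
    rcases mem_withGrandparents.1 hv with h | ⟨a, ha, har, rfl⟩
    · exact (hS.1 h).2
    · obtain ⟨h1, h2, -, -⟩ := hA.grandparent_spec hG hr (hS.1 ha).1 har
      exact (hball a (hS.1 ha).1 (hS.1 ha).2 _ (.of_adj_adj h1 h2)).1
  have hKpart : ∀ v ∈ K, ∃ w ∈ K, w ≠ v ∧ Within2 G v w := by
    intro v hv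
    obtain ⟨w, hw, hwv, c, h1, h2, -⟩ := hA.partner_withGrandparents hG hr
      (fun a ha => (hS.1 ha).1) hv (fun h => hKP v hv (h ▸ hrP))
    exact ⟨w, hw, hwv, .of_adj_adj h1 h2⟩
  -- a vertex of `K` adjacent to `b`
  obtain ⟨x, hxK, hxP, hbx⟩ : ∃ x ∈ K, x ∉ P ∧ G.Adj b x := by
    refine (hex b hP.right (fun h => hb b h (.refl _))
      fun a ha h => hb a ha (.of_adj h.symm)).resolve_left fun hbK => ?_
    rcases mem_withGrandparents.1 hbK with h | ⟨a, ha, har, hgb⟩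
    · exact hb b (hS.1 h).1 (.refl _)
    · obtain ⟨h1, h2, -, -⟩ := hA.grandparent_spec hG hr (hS.1 ha).1 har
      exact hb a (hS.1 ha).1 (hgb ▸ .of_adj_adj h1 h2)
  obtain ⟨D, hD, hDc⟩ := exists_semitotalDominating_card_eq
    (exists_adj_subdivide (p := p) (q := b) (k := 2) hdeg (by norm_num))
  have hDle : D.card ≤ semitotalDominationNumber G := hDc ▸ hsub p hbp.symm
  set B : Finset (V ⊕ Fin 2) := S.biUnion fun a => (ball2 G a).map .inl with hBdef
  have hB : 2 * S.card ≤ (D ∩ B).card := by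
    refine two_mul_card_le_subdivide hG hdeg hA (fun a ha => ?_) hD
    obtain ⟨ha, haP⟩ := hS.1 ha
    have key : ∀ w, Within2 G a w → w ≠ p ∧ w ≠ b := fun w hw =>
      ⟨fun h => (hball a ha haP w hw).1 (h ▸ hP.left), (hball a ha haP w hw).2⟩
    exact ⟨ha, key a (.refl _), fun c hc => key c (.of_adj hc)⟩
  have hBmem : ∀ y ∈ B, ∃ v, y = .inl v ∧ v ∉ P ∧ v ≠ b := by
    intro y hy
    obtain ⟨a, ha, hy⟩ := Finset.mem_biUnion.1 hy
    obtain ⟨v, hv, rfl⟩ := Finset.mem_map.1 hy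
    have := hball a (hS.1 ha).1 (hS.1 ha).2 v (mem_ball2.1 hv)
    exact ⟨v, rfl, this⟩
  set Z : Finset (V ⊕ Fin 2) := {.inr 0, .inr 1, .inl b} with hZdef
  have hcount : (trace P D).card + 2 * S.card + (D ∩ Z).card ≤ semitotalDominationNumber G := by
    have hdisj : Disjoint (D ∩ B) (D ∩ Z) := by
      rw [Finset.disjoint_left]
      intro y hy hy'
      obtain ⟨v, rfl, -, hvb⟩ := hBmem y (Finset.mem_inter.1 hy).2
      have := (Finset.mem_inter.1 hy').2
      simp [hZdef] at this
      exact hvb this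
    have h1 := card_trace_add_card_le (P := P) (D := D) (R := D ∩ B ∪ D ∩ Z)
      (Finset.union_subset Finset.inter_subset_left Finset.inter_subset_left) (by
        intro v hv
        rcases Finset.mem_union.1 hv with hv | hv
        · obtain ⟨w, hw, hwP, -⟩ := hBmem _ (Finset.mem_inter.1 hv).2
          exact Sum.inl_injective hw ▸ hwP
        · have := (Finset.mem_inter.1 hv).2
          simp [hZdef] at this
          exact this ▸ hP.right)
    rw [Finset.card_union_of_disjoint hdisj] at h1
    omega
  have hunion : (trace P D ∪ K).card ≤ (trace P D).card + 2 * S.card :=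
    (Finset.card_union_le _ _).trans (by omega)
  have hZpos : 0 < (D ∩ Z).card := by
    rw [Finset.card_pos]
    rcases exists_mem_near hD with h | h | h
    · exact ⟨_, Finset.mem_inter.2 ⟨h, by simp [hZdef]⟩⟩
    · exact ⟨_, Finset.mem_inter.2 ⟨h, by simp [hZdef]⟩⟩
    · exact ⟨_, Finset.mem_inter.2 ⟨h, by simp [hZdef]⟩⟩
  have hins : semitotalDominationNumber G ≤ (insert p (trace P D ∪ K)).card := by
    have hE := hP.except_insert hD (K := K)
      (fun v hv hvK => (hKdom v hv hvK).imp fun w hw => ⟨Finset.mem_insert_of_mem hw.1, hw.2⟩)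
      hKpart
    refine semitotalDominationNumber_le
      (isSemitotalDominating_iff.2 ⟨hE.dominating, fun v hv => ?_⟩)
    by_cases hvp : v = p
    · subst hvp
      exact ⟨x, by simp [hxK], fun h => hxP (h ▸ hP.left), .of_adj_adj hbp.symm hbx⟩
    · exact hE.partner v hv hvp
  have hpE : p ∉ trace P D ∪ K := by
    intro h
    rw [Finset.insert_eq_of_mem h] at hins
    omega
  have hpD : .inl p ∉ D := fun h => hpE (Finset.mem_union_left _ (mem_trace.2 ⟨hP.left, h⟩))
  rw [Finset.card_insert_of_notMem hpE] at hins
  have hone : ∀ y ∈ D ∩ Z, ∀ z ∈ D ∩ Z, y = z := Finset.card_le_one.1 (by omega)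
  by_cases h0 : .inr 0 ∈ D
  · -- the partner of the new neighbour of `p` is a neighbour `u` of `p`, which is then deficient
    have h0Z : .inr 0 ∈ D ∩ Z := Finset.mem_inter.2 ⟨h0, by simp [hZdef]⟩
    obtain ⟨y, hy, hy0, h⟩ := (isSemitotalDominating_iff.1 hD).2 _ h0
    have hyZ : y ∉ Z := fun h => hy0 (hone y (Finset.mem_inter.2 ⟨hy, h⟩) _ h0Z)
    obtain ⟨u, hyu, hpu, hne⟩ : ∃ u, y = .inl u ∧ G.Adj p u ∧ u ≠ b := by
      rcases y with u | i
      · have hub : u ≠ b := by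
          rintro rfl
          exact hyZ (by simp [hZdef])
        refine ⟨u, rfl, ?_, hub⟩
        rcases h with h | (⟨rfl, -⟩ | ⟨h, -⟩) | ⟨z, h, h'⟩
        · simp at h
        · exact absurd hy hpD
        · exact absurd h hub
        · rcases z with z | i
          · rcases h with ⟨rfl, -⟩ | ⟨-, h⟩
            · exact h'.1
            · simp at h
          · rcases h with h | h
            · rcases h' with ⟨rfl, -⟩ | ⟨rfl, -⟩
              · exact absurd hy hpD
              · exact absurd rfl hub
            · simp at h
      · exfalso
        apply hyZ
        fin_cases i <;> simp [hZdef]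
    have huP : u ∈ P := by
      by_contra huP
      exact hne (hP.across p u hP.left huP hpu).2
    have huE : u ∈ trace P D := mem_trace.2 ⟨huP, hyu ▸ hy⟩
    obtain ⟨h1, h2⟩ := hP.union_dominating hD hpD (fun _ => ⟨huE, hpu⟩) hKdom hKpart
    exact hb u ⟨_, ⟨h1, Finset.mem_union_left _ huE, h2⟩, by omega⟩ (.of_adj_adj hpu.symm hbp.symm)
  · obtain ⟨h1, h2⟩ := hP.union_dominating hD (u := p) hpD (fun h => absurd h h0) hKdom hKpart
    have := semitotalDominationNumber_le (isSemitotalDominating_iff.2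
      ⟨h1, fun v hv => h2 v hv fun h => hpE (h ▸ hv)⟩)
    omega

/-- If no double subdivision of an edge increases the semitotal domination number, the deficient
vertices form a perfect code containing all support vertices. -/
theorem isLeafyCode_deficient (hG : G.IsTree) (hV : 3 ≤ Fintype.card V)
    (hsub : ∀ p b, G.Adj p b →
      semitotalDominationNumber (subdivideEdge G p b 2) ≤ semitotalDominationNumber G) :
    IsLeafyCode G (deficient G) := by
  classical
  have hdeg := exists_adj_of_tree hG hV
  have hA : IsLeafyPacking G (deficient G) :=
    ⟨fun a ha a' ha' v h h' => deficient_unique hG hV ha ha' h h',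
      fun l s h hl => support_mem_deficient hdeg h hl (hsub s l h.symm)⟩
  refine ⟨hA, ?_⟩
  have : Nontrivial V := Fintype.one_lt_card_iff_nontrivial.1 (by omega)
  obtain ⟨r, hr⟩ : ∃ r, r ∈ deficient G := by
    obtain ⟨l, hl⟩ := hG.exists_vert_degree_one_of_nontrivial
    obtain ⟨s, hs⟩ := hdeg l
    refine ⟨s, hA.leaf l s hs fun w hw => ?_⟩
    rw [SimpleGraph.degree, Finset.card_eq_one] at hl
    obtain ⟨t, ht⟩ := hl
    have h1 := (SimpleGraph.mem_neighborFinset _ _ _).2 hs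
    have h2 := (SimpleGraph.mem_neighborFinset _ _ _).2 hw
    rw [ht, Finset.mem_singleton] at h1 h2
    rw [h1, h2]
  by_contra hcon
  push Not at hcon
  obtain ⟨v, hv⟩ := hcon
  obtain ⟨b, hb, hmax⟩ := Finset.exists_max_image
    (Finset.univ.filter fun v => ∀ a ∈ deficient G, ¬ Within2 G a v) (G.dist r)
    ⟨v, by simpa using hv⟩
  simp only [Finset.mem_filter, Finset.mem_univ, true_and] at hb hmax
  obtain ⟨a, ha, hab⟩ := exists_deficient_within2 hG hV hA hr
    (fun h => hb r hr (h ▸ .refl _)) (fun w hw => by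
      by_contra hcon
      push Not at hcon
      exact absurd (hmax w hcon) (by omega)) (fun p hp => hsub p b hp)
  exact hb a ha hab

end FiniteTree

/-! ### A perfect code determines the multisubdivision number -/

section Iso

variable {W : Type*} {H : SimpleGraph W}

lemma Within2.map (e : G ≃g H) {x y : V} (h : Within2 G x y) : Within2 H (e x) (e y) := by
  rcases h with rfl | h | ⟨z, h, h'⟩
  · exact .refl _
  · exact .of_adj (e.map_adj_iff.2 h)
  · exact .of_adj_adj (e.map_adj_iff.2 h) (e.map_adj_iff.2 h')

lemma IsSemitotalDominating.map (e : G ≃g H) {D : Finset V} (h : IsSemitotalDominating G D) :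
    IsSemitotalDominating H (D.map e.toEquiv.toEmbedding) := by
  rw [isSemitotalDominating_iff] at h ⊢
  refine ⟨fun v hv => ?_, fun v hv => ?_⟩
  · obtain ⟨w, hw, ha⟩ := h.1 (e.symm v) fun hD => hv (Finset.mem_map.2 ⟨_, hD, by simp⟩)
    refine ⟨e w, Finset.mem_map_of_mem _ hw, ?_⟩
    have := e.map_adj_iff.2 ha
    simpa using this
  · obtain ⟨v, hvD, rfl⟩ := Finset.mem_map.1 hv
    obtain ⟨w, hw, hne, h2⟩ := h.2 v hvD
    exact ⟨e w, Finset.mem_map_of_mem _ hw, fun h => hne (e.injective h), h2.map e⟩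

lemma semitotalDominationNumber_congr (e : G ≃g H) :
    semitotalDominationNumber G = semitotalDominationNumber H := by
  unfold semitotalDominationNumber
  congr 1
  ext n
  constructor
  · rintro ⟨D, hD, rfl⟩
    exact ⟨_, hD.map e, Finset.card_map _⟩
  · rintro ⟨D, hD, rfl⟩
    exact ⟨_, hD.map e.symm, Finset.card_map _⟩

end Iso

/-- The two orientations of the subdivided edge give isomorphic graphs. -/
def subdivideSwap (G : SimpleGraph V) (p q : V) (k : ℕ) :
    subdivideEdge G p q k ≃g subdivideEdge G q p k where
  toEquiv := Equiv.sumCongr (Equiv.refl V) Fin.revPerm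
  map_rel_iff' := by
    rintro (a | i) (b | j)
    · simp [subdivideEdge, Sym2.eq_swap (a := p) (b := q)]
    · simp only [subdivideEdge, Equiv.sumCongr_apply, Sum.map_inl, Sum.map_inr, Fin.revPerm_apply,
        Fin.val_rev, Equiv.refl_apply]
      have := j.isLt
      constructor <;> (rintro (⟨h, h'⟩ | ⟨h, h'⟩) <;> [right; left] <;> exact ⟨h, by omega⟩)
    · simp only [subdivideEdge, Equiv.sumCongr_apply, Sum.map_inl, Sum.map_inr, Fin.revPerm_apply,
        Fin.val_rev, Equiv.refl_apply]
      have := i.isLt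
      constructor <;> (rintro (⟨h, h'⟩ | ⟨h, h'⟩) <;> [right; left] <;> exact ⟨h, by omega⟩)
    · simp only [subdivideEdge, Equiv.sumCongr_apply, Sum.map_inr, Fin.revPerm_apply, Fin.val_rev]
      have := i.isLt
      have := j.isLt
      constructor <;> (rintro (h | h) <;> [right; left] <;> omega)

section PerfectCode

variable [Fintype V] {A : Set V}

section Code

open Classical in
/-- The vertices of the code as a finite set. -/
noncomputable def codeFinset (A : Set V) : Finset V := Finset.univ.filter (· ∈ A)

lemma mem_codeFinset {a : V} : a ∈ codeFinset A ↔ a ∈ A := by simp [codeFinset]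

lemma IsLeafyCode.two_mul_card_le (hA : IsLeafyCode G A) (hG : G.IsTree)
    (hdeg : ∀ v, ∃ w, G.Adj v w) : 2 * (codeFinset A).card ≤ semitotalDominationNumber G := by
  classical
  obtain ⟨D, hD, hDc⟩ := exists_semitotalDominating_card_eq hdeg
  rw [← hDc]
  refine (SemitotalMsd.two_mul_card_le (S := codeFinset A) (c := id) (F := ball2 G) hD
    (fun a _ w hw => mem_ball2.2 hw) ?_ ?_ ?_).trans (Finset.card_le_card Finset.inter_subset_left)
  · intro a ha b hb hab
    rw [Finset.disjoint_left]
    intro w hw hw'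
    exact hab (hA.unique a (mem_codeFinset.1 ha) b (mem_codeFinset.1 hb) w (mem_ball2.1 hw)
      (mem_ball2.1 hw'))
  · intro a ha
    exact hA.exists_two_neighbors hdeg (mem_codeFinset.1 ha)
  · intro a _ x y hx hy
    exact not_adj_of_common_neighbor hG hx hy

/-- A vertex not dominated by the code is the grandparent of a code vertex or has a child that is
one. -/
lemma IsLeafyCode.mem_or_child (hA : IsLeafyCode G A) (hG : G.IsTree) {r v : V} (hr : r ∈ A)
    (hvA : v ∉ A) (hv : ∀ a ∈ A, ¬ G.Adj v a) :
    v ∈ withGrandparents G r (codeFinset A) ∨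
      ∃ x ∈ withGrandparents G r (codeFinset A), G.Adj v x ∧ G.dist r x = G.dist r v + 1 := by
  rcases hA.exists_grandparent hG hr hvA hv (fun x _ _ => hA.cover x) with
    ⟨a, ha, har, h⟩ | ⟨x, hx, hxd, a, ha, har, h⟩
  · exact Or.inl (mem_withGrandparents.2 (Or.inr ⟨a, mem_codeFinset.2 ha, har, h⟩))
  · exact Or.inr ⟨x, mem_withGrandparents.2 (Or.inr ⟨a, mem_codeFinset.2 ha, har, h⟩), hx, hxd⟩

lemma IsLeafyCode.dominating (hA : IsLeafyCode G A) (hG : G.IsTree) {r : V} (hr : r ∈ A) :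
    IsDominating G (withGrandparents G r (codeFinset A)) := by
  intro v hv
  have hvA : v ∉ A := fun h => hv (mem_withGrandparents.2 (Or.inl (mem_codeFinset.2 h)))
  by_cases hva : ∃ a ∈ A, G.Adj v a
  · obtain ⟨a, ha, h⟩ := hva
    exact ⟨a, mem_withGrandparents.2 (Or.inl (mem_codeFinset.2 ha)), h⟩
  · push Not at hva
    rcases hA.mem_or_child hG hr hvA hva with h | ⟨x, hx, h, -⟩
    · exact absurd h hv
    · exact ⟨x, hx, h⟩

lemma IsLeafyCode.le_two_mul_card (hA : IsLeafyCode G A) (hG : G.IsTree)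
    (hdeg : ∀ v, ∃ w, G.Adj v w) {r : V} (hr : r ∈ A) :
    semitotalDominationNumber G ≤ 2 * (codeFinset A).card := by
  classical
  obtain ⟨c, hc⟩ := hdeg r
  have hrK : r ∈ withGrandparents G r (codeFinset A) :=
    mem_withGrandparents.2 (Or.inl (mem_codeFinset.2 hr))
  have hcard := card_withGrandparents_lt (G := G) (mem_codeFinset.2 hr)
  have hins := Finset.card_insert_le c (withGrandparents G r (codeFinset A))
  refine (semitotalDominationNumber_le (D := insert c (withGrandparents G r (codeFinset A)))
    (isSemitotalDominating_iff.2 ⟨fun v hv => ?_, fun v hv => ?_⟩)).trans (by omega)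
  · obtain ⟨w, hw, h⟩ := hA.dominating hG hr v fun h => hv (Finset.mem_insert_of_mem h)
    exact ⟨w, Finset.mem_insert_of_mem hw, h⟩
  · by_cases hvr : v = r
    · subst hvr
      exact ⟨c, Finset.mem_insert_self _ _, hc.ne', .of_adj hc⟩
    rcases Finset.mem_insert.1 hv with rfl | hv
    · exact ⟨r, Finset.mem_insert_of_mem hrK, hc.ne, .of_adj hc.symm⟩
    · obtain ⟨w, hw, hwv, d, h1, h2, -⟩ := hA.partner_withGrandparents hG hr
        (fun a ha => mem_codeFinset.1 ha) hv hvr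
      exact ⟨w, Finset.mem_insert_of_mem hw, hwv, .of_adj_adj h1 h2⟩

variable {p q r : V} {k : ℕ}

/-- The code, the grandparents of its vertices with respect to a root `r` in the code, and one more
vertex `z` near `r` form a semitotal dominating set of a subdivided graph, provided that the
subdivided edge is not close to other code vertices, and that the vertices on the subdivided edge
are dominated. -/
lemma IsLeafyCode.subdivide_le [DecidableEq V] (hA : IsLeafyCode G A) (hG : G.IsTree) (hr : r ∈ A)
    {z : V ⊕ Fin k} {D : Finset (V ⊕ Fin k)}
    (hDdef : D = insert z ((withGrandparents G r (codeFinset A)).map .inl))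
    (hfar : ∀ a ∈ A, a ≠ r → ∀ c, G.Adj a c → c ≠ p ∧ c ≠ q)
    (hz : z ≠ .inl r) (hrz : Within2 (subdivideEdge G p q k) (.inl r) z)
    (hp : .inl p ∈ D ∨ ∃ w ∈ D, (subdivideEdge G p q k).Adj (.inl p) w)
    (hq : .inl q ∈ D ∨ ∃ w ∈ D, (subdivideEdge G p q k).Adj (.inl q) w)
    (hi : ∀ i, .inr i ∈ D ∨ ∃ w ∈ D, (subdivideEdge G p q k).Adj (.inr i) w) :
    semitotalDominationNumber (subdivideEdge G p q k) ≤ 2 * (codeFinset A).card := by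
  have hcard := card_withGrandparents_lt (G := G) (mem_codeFinset.2 hr)
  have hDcard : D.card ≤ 2 * (codeFinset A).card := by
    have := Finset.card_insert_le z ((withGrandparents G r (codeFinset A)).map .inl)
    rw [Finset.card_map] at this
    rw [hDdef]
    omega
  have hKD : ∀ v ∈ withGrandparents G r (codeFinset A), .inl v ∈ D := fun v hv => by
    rw [hDdef]
    exact Finset.mem_insert_of_mem (Finset.mem_map_of_mem _ hv)
  have hrD : .inl r ∈ D := hKD r (mem_withGrandparents.2 (Or.inl (mem_codeFinset.2 hr)))
  have hzD : z ∈ D := by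
    rw [hDdef]
    exact Finset.mem_insert_self _ _
  refine (semitotalDominationNumber_le (D := D)
    (isSemitotalDominating_iff.2 ⟨fun v hv => ?_, fun v hv => ?_⟩)).trans hDcard
  · rcases v with v | i
    · by_cases hvp : v = p
      · exact hvp ▸ hp.resolve_left fun h => hv (hvp ▸ h)
      by_cases hvq : v = q
      · exact hvq ▸ hq.resolve_left fun h => hv (hvq ▸ h)
      obtain ⟨w, hw, h⟩ := hA.dominating hG hr v fun h => hv (hKD v h)
      refine ⟨_, hKD w hw, h, fun hs => ?_⟩
      rcases Sym2.mem_iff.1 (hs ▸ Sym2.mem_mk_left v w) with h | h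
      · exact hvp h
      · exact hvq h
    · exact (hi i).resolve_left hv
  · by_cases hvr : v = .inl r
    · subst hvr
      exact ⟨z, hzD, hz, hrz⟩
    rw [hDdef] at hv
    rcases Finset.mem_insert.1 hv with rfl | hv
    · exact ⟨_, hrD, hz.symm, hrz.symm⟩
    obtain ⟨v, hvK, rfl⟩ := Finset.mem_map.1 hv
    have hvr' : v ≠ r := fun h => hvr (h ▸ rfl)
    obtain ⟨w, hw, hwv, c, h1, h2, h3⟩ := hA.partner_withGrandparents hG hr
      (fun a ha => mem_codeFinset.1 ha) hvK hvr'
    have hc : c ≠ p ∧ c ≠ q := by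
      rcases h3 with ⟨-, h⟩ | ⟨-, h, h'⟩
      · exact hfar v h hvr' c h1
      · exact hfar w h h' c h2.symm
    have hcs : ∀ x, s(c, x) ≠ s(p, q) := by
      intro x h
      rcases Sym2.mem_iff.1 (h ▸ Sym2.mem_mk_left c x) with h | h
      · exact hc.1 h
      · exact hc.2 h
    refine ⟨.inl w, hKD w hw, fun h => hwv (Sum.inl_injective h), ?_⟩
    exact .of_adj_adj (subdivide_adj_inl h1 (by rw [Sym2.eq_swap]; exact hcs v))
      (subdivide_adj_inl h2 (hcs w))

/-- The added vertex is the neighbour of `q` on the subdivided edge, or `q` itself if there is only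
one subdivision vertex. -/
lemma IsLeafyCode.subdivide_code_edge (hA : IsLeafyCode G A) (hG : G.IsTree) (hr : r ∈ A)
    (h : G.Adj r q) (hk : k = 1 ∨ k = 2) :
    semitotalDominationNumber (subdivideEdge G r q k) ≤ 2 * (codeFinset A).card := by
  classical
  have hfar : ∀ a ∈ A, a ≠ r → ∀ c, G.Adj a c → c ≠ r ∧ c ≠ q := by
    intro a ha har c hac
    constructor
    · rintro rfl
      exact har (hA.unique a ha c hr c (.of_adj hac) (.refl _))
    · rintro rfl
      exact har (hA.unique a ha r hr c (.of_adj hac) (.of_adj h))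
  have hrK : r ∈ withGrandparents G r (codeFinset A) :=
    mem_withGrandparents.2 (Or.inl (mem_codeFinset.2 hr))
  rcases hk with rfl | rfl
  · refine hA.subdivide_le hG hr (z := .inl q) rfl hfar (fun h' => h.ne' (Sum.inl_injective h'))
      (.of_adj_adj (z := .inr 0) (Or.inl ⟨rfl, rfl⟩) (Or.inr ⟨rfl, rfl⟩)) (Or.inl ?_)
      (Or.inl ?_) (fun i => Or.inr ⟨.inl r, ?_, Or.inl ⟨rfl, by omega⟩⟩)
    · exact Finset.mem_insert_of_mem (Finset.mem_map_of_mem _ hrK)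
    · exact Finset.mem_insert_self _ _
    · exact Finset.mem_insert_of_mem (Finset.mem_map_of_mem _ hrK)
  · refine hA.subdivide_le hG hr (z := .inr 1) rfl hfar (by simp)
      (.of_adj_adj (z := .inr 0) (Or.inl ⟨rfl, rfl⟩) (Or.inl rfl)) (Or.inl ?_)
      (Or.inr ⟨.inr 1, ?_, Or.inr ⟨rfl, rfl⟩⟩) (fun i => ?_)
    · exact Finset.mem_insert_of_mem (Finset.mem_map_of_mem _ hrK)
    · exact Finset.mem_insert_self _ _
    · fin_cases i
      · exact Or.inr ⟨.inl r, Finset.mem_insert_of_mem (Finset.mem_map_of_mem _ hrK),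
          Or.inl ⟨rfl, rfl⟩⟩
      · exact Or.inl (Finset.mem_insert_self _ _)

/-- The added vertex is the neighbour of `p` on the subdivided edge; the other end `q` is dominated
from below. -/
lemma IsLeafyCode.subdivide_neighbor_edge (hA : IsLeafyCode G A) (hG : G.IsTree) (hr : r ∈ A)
    (hrp : G.Adj r p) (h : G.Adj p q) (hqA : q ∉ A) (hq : ∀ a ∈ A, ¬ G.Adj q a)
    (hk : k = 1 ∨ k = 2) :
    semitotalDominationNumber (subdivideEdge G p q k) ≤ 2 * (codeFinset A).card := by
  classical
  have hrq : r ≠ q := fun h => hqA (h ▸ hr)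
  have hfar : ∀ a ∈ A, a ≠ r → ∀ c, G.Adj a c → c ≠ p ∧ c ≠ q := by
    intro a ha har c hac
    constructor
    · rintro rfl
      exact har (hA.unique a ha r hr c (.of_adj hac) (.of_adj hrp))
    · rintro rfl
      exact hq a ha hac.symm
  have hrK : r ∈ withGrandparents G r (codeFinset A) :=
    mem_withGrandparents.2 (Or.inl (mem_codeFinset.2 hr))
  have hkpos : 0 < k := by omega
  have hpd : G.dist r p = 1 := SimpleGraph.dist_eq_one_iff_adj.2 hrp
  have hqd : G.dist r q ≠ 0 := fun h => hrq ((hG.connected.dist_eq_zero_iff).1 h)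
  have hpq := adj_dist hG r h
  have hrps : s(r, p) ≠ s(p, q) := by
    intro hs
    have : q ∈ s(r, p) := hs ▸ Sym2.mem_mk_right p q
    rcases Sym2.mem_iff.1 this with h' | h'
    · exact hrq h'.symm
    · exact h.ne' h'
  refine hA.subdivide_le hG hr (z := .inr ⟨0, hkpos⟩) rfl hfar (by simp)
    (.of_adj_adj (z := .inl p) (subdivide_adj_inl hrp hrps) (Or.inl ⟨rfl, rfl⟩))
    (Or.inr ⟨_, Finset.mem_insert_self _ _, Or.inl ⟨rfl, rfl⟩⟩) ?_ (fun i => ?_)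
  · rcases hA.mem_or_child hG hr hqA hq with h' | ⟨x, hx, hqx, hxd⟩
    · exact Or.inl (Finset.mem_insert_of_mem (Finset.mem_map_of_mem _ h'))
    · refine Or.inr ⟨.inl x, Finset.mem_insert_of_mem (Finset.mem_map_of_mem _ hx),
        subdivide_adj_inl hqx fun hs => ?_⟩
      have : p ∈ s(q, x) := hs ▸ Sym2.mem_mk_left p q
      rcases Sym2.mem_iff.1 this with h' | rfl
      · exact h.ne h'
      · omega
  · by_cases hi : i.val = 0
    · exact Or.inl (Finset.mem_insert.2 (Or.inl (congrArg _ (Fin.ext hi))))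
    · exact Or.inr ⟨_, Finset.mem_insert_self _ _, Or.inr (by simp; omega)⟩

/-- The root is the code vertex near `p`, and the added vertex is `p`; the other end `q` is then the
grandparent of the code vertex near it. -/
lemma IsLeafyCode.subdivide_far_edge (hA : IsLeafyCode G A) (hG : G.IsTree)
    (h : G.Adj p q) (hpA : p ∉ A) (hp : ∀ a ∈ A, ¬ G.Adj p a) (hqA : q ∉ A)
    (hq : ∀ a ∈ A, ¬ G.Adj q a) (hk : k = 1 ∨ k = 2) :
    semitotalDominationNumber (subdivideEdge G p q k) ≤ 2 * (codeFinset A).card := by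
  classical
  obtain ⟨r, hr, hrp⟩ := hA.cover p
  obtain ⟨a, ha, haq⟩ := hA.cover q
  rcases hrp with rfl | hrp | ⟨c, hrc, hcp⟩
  · exact absurd hr hpA
  · exact absurd hrp.symm (hp r hr)
  rcases haq with rfl | haq | ⟨d, had, hdq⟩
  · exact absurd ha hqA
  · exact absurd haq.symm (hq a ha)
  have hcq : c ≠ q := by
    rintro rfl
    exact hq r hr hrc.symm
  have hdp : d ≠ p := by
    rintro rfl
    exact hp a ha had.symm
  have hrp : r ≠ p := fun h => hpA (h ▸ hr)
  -- distances from `r` along the path `r, c, p, q, d, a`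
  have hcd : G.dist r c = G.dist r r + 1 := by
    rw [SimpleGraph.dist_self, SimpleGraph.dist_eq_one_iff_adj.2 hrc]
  have hpd := dist_step hG hrc hcp hrp hcd
  have hqd := dist_step hG hcp h hcq hpd
  have hdd := dist_step hG h hdq.symm (Ne.symm hdp) hqd
  have hqa : q ≠ a := fun h => hqA (h ▸ ha)
  have had' := dist_step hG hdq.symm had.symm hqa hdd
  have hgp : grandparent G r a = q := by
    rw [grandparent, parent_eq hG had had', parent_eq hG hdq hdd]
  have har : a ≠ r := by
    rintro rfl
    rw [SimpleGraph.dist_self] at had'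
    omega
  have hqK : q ∈ withGrandparents G r (codeFinset A) :=
    mem_withGrandparents.2 (Or.inr ⟨a, mem_codeFinset.2 ha, har, hgp⟩)
  have hfar : ∀ a ∈ A, a ≠ r → ∀ c, G.Adj a c → c ≠ p ∧ c ≠ q := by
    intro a ha _ c hac
    constructor
    · rintro rfl
      exact hp a ha hac.symm
    · rintro rfl
      exact hq a ha hac.symm
  have hkpos : 0 < k := by omega
  have hcs : ∀ x, s(c, x) ≠ s(p, q) := by
    intro x h
    rcases Sym2.mem_iff.1 (h ▸ Sym2.mem_mk_left c x) with h | h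
    · exact hcp.ne h
    · exact hcq h
  refine hA.subdivide_le hG hr (z := .inl p) rfl hfar (fun h => hrp (Sum.inl_injective h).symm)
    (.of_adj_adj (z := .inl c) (subdivide_adj_inl hrc (by rw [Sym2.eq_swap]; exact hcs r))
      (subdivide_adj_inl hcp (hcs p)))
    (Or.inl (Finset.mem_insert_self _ _))
    (Or.inl (Finset.mem_insert_of_mem (Finset.mem_map_of_mem _ hqK))) (fun i => Or.inr ?_)
  by_cases hi : i.val = 0
  · exact ⟨.inl p, Finset.mem_insert_self _ _, Or.inl ⟨rfl, hi⟩⟩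
  · exact ⟨.inl q, Finset.mem_insert_of_mem (Finset.mem_map_of_mem _ hqK),
      Or.inr ⟨rfl, by omega⟩⟩

/-- Subdividing an edge once or twice does not increase the semitotal domination number of a tree
with a perfect code containing all support vertices. -/
lemma IsLeafyCode.subdivide_le_of_le_two (hA : IsLeafyCode G A) (hG : G.IsTree)
    (h : G.Adj p q) (hk : k = 1 ∨ k = 2) :
    semitotalDominationNumber (subdivideEdge G p q k) ≤ 2 * (codeFinset A).card := by
  by_cases hpA : p ∈ A
  · exact hA.subdivide_code_edge hG hpA h hk
  by_cases hqA : q ∈ A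
  · rw [semitotalDominationNumber_congr (subdivideSwap G p q k)]
    exact hA.subdivide_code_edge hG hqA h.symm hk
  -- the ends of an edge do not both have a neighbour in the code
  have key : ∀ x y, G.Adj x y → ∀ a ∈ A, G.Adj a x → ∀ b ∈ A, ¬ G.Adj y b := by
    intro x y hxy a ha hax b hb hyb
    have := hA.unique a ha b hb x (.of_adj hax) (.of_adj_adj hyb.symm hxy.symm)
    subst this
    exact not_adj_of_common_neighbor hG hax hyb.symm hxy
  by_cases hp : ∃ a ∈ A, G.Adj a p
  · obtain ⟨r, hr, hrp⟩ := hp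
    exact hA.subdivide_neighbor_edge hG hr hrp h hqA (key p q h r hr hrp) hk
  by_cases hq : ∃ a ∈ A, G.Adj a q
  · obtain ⟨r, hr, hrq⟩ := hq
    rw [semitotalDominationNumber_congr (subdivideSwap G p q k)]
    exact hA.subdivide_neighbor_edge hG hr hrq h.symm hpA (key q p h.symm r hr hrq) hk
  push Not at hp hq
  exact hA.subdivide_far_edge hG h hpA (fun a ha h' => hp a ha h'.symm) hqA
    (fun a ha h' => hq a ha h'.symm) hk

end Code

/-- After an edge from a code vertex `a` to `c` has been subdivided three times, the enlarged ball
around `a` contains at least three vertices of every semitotal dominating set. -/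
lemma three_le_card_inter [DecidableEq V] (hG : G.IsTree) {a c c' : V} (hc : G.Adj a c)
    (hc' : G.Adj a c') (hne : c ≠ c') {D : Finset (V ⊕ Fin 3)}
    (hD : IsSemitotalDominating (subdivideEdge G a c 3) D) :
    2 < (D ∩ ((ball2 G a).map .inl ∪ Finset.univ.map .inr)).card := by
  obtain ⟨hdom, hpart⟩ := isSemitotalDominating_iff.1 hD
  set F : Finset (V ⊕ Fin 3) := (ball2 G a).map .inl ∪ Finset.univ.map .inr with hF
  have hFl : ∀ v, Within2 G a v → .inl v ∈ F := fun v hv =>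
    Finset.mem_union_left _ (Finset.mem_map_of_mem _ (mem_ball2.2 hv))
  have hFr : ∀ i, .inr i ∈ F := fun i =>
    Finset.mem_union_right _ (Finset.mem_map_of_mem _ (Finset.mem_univ i))
  have tri : ∀ {x}, G.Adj a x → ∀ {y}, G.Adj a y → ¬ G.Adj x y :=
    fun hx _ hy => not_adj_of_common_neighbor hG hx hy
  have nonbr : ∀ {y}, s(c, y) ≠ s(a, c) → y ≠ a := by
    rintro y h rfl
    exact h Sym2.eq_swap
  by_contra hcard
  have hthree : ∀ x ∈ D ∩ F, ∀ y ∈ D ∩ F, ∀ z ∈ D ∩ F, x = y ∨ x = z ∨ y = z := by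
    intro x hx y hy z hz
    by_contra hcon
    push Not at hcon
    exact hcard (Finset.two_lt_card.2 ⟨x, hx, y, hy, z, hz, hcon⟩)
  -- a vertex dominating the middle subdivision vertex
  obtain ⟨i, hi⟩ : ∃ i, .inr i ∈ D ∩ F := by
    by_cases h : .inr 1 ∈ D
    · exact ⟨1, Finset.mem_inter.2 ⟨h, hFr _⟩⟩
    · obtain ⟨y, hy, h⟩ := hdom _ h
      rcases y with w | i
      · rcases h with ⟨-, h⟩ | ⟨-, h⟩ <;> simp at h
      · exact ⟨i, Finset.mem_inter.2 ⟨hy, hFr _⟩⟩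
  -- a vertex dominating `a`
  obtain ⟨y, hy, hya⟩ : ∃ y ∈ D ∩ F,
      y = .inl a ∨ y = .inr 0 ∨ ∃ x, y = .inl x ∧ G.Adj a x ∧ x ≠ c := by
    by_cases h : .inl a ∈ D
    · exact ⟨_, Finset.mem_inter.2 ⟨h, hFl _ (.refl _)⟩, Or.inl rfl⟩
    · obtain ⟨y, hy, h⟩ := hdom _ h
      rcases y with w | i
      · exact ⟨_, Finset.mem_inter.2 ⟨hy, hFl _ (.of_adj h.1)⟩, Or.inr (Or.inr ⟨w, rfl, h.1, by
          rintro rfl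
          exact h.2 rfl⟩)⟩
      · rcases h with ⟨-, h⟩ | ⟨h, -⟩
        · exact ⟨_, Finset.mem_inter.2 ⟨hy, hFr _⟩, Or.inr (Or.inl (congrArg _ (Fin.ext h)))⟩
        · exact absurd h hc.ne
  -- a vertex dominating `c`
  obtain ⟨z, hz, hzc⟩ : ∃ z ∈ D ∩ F,
      z = .inl c ∨ z = .inr 2 ∨ ∃ x, z = .inl x ∧ G.Adj c x ∧ x ≠ a := by
    by_cases h : .inl c ∈ D
    · exact ⟨_, Finset.mem_inter.2 ⟨h, hFl _ (.of_adj hc)⟩, Or.inl rfl⟩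
    · obtain ⟨y, hy, h⟩ := hdom _ h
      rcases y with w | i
      · exact ⟨_, Finset.mem_inter.2 ⟨hy, hFl _ (.of_adj_adj hc h.1)⟩,
          Or.inr (Or.inr ⟨w, rfl, h.1, nonbr h.2⟩)⟩
      · rcases h with ⟨h, -⟩ | ⟨-, h⟩
        · exact absurd h hc.ne'
        · exact ⟨_, Finset.mem_inter.2 ⟨hy, hFr _⟩, Or.inr (Or.inl (congrArg _ (Fin.ext (by
            simpa using h))))⟩
  -- a vertex dominating `c'`
  obtain ⟨x, hx, hxc⟩ : ∃ x, .inl x ∈ D ∩ F ∧ (x = c' ∨ G.Adj c' x) := by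
    by_cases h : .inl c' ∈ D
    · exact ⟨_, Finset.mem_inter.2 ⟨h, hFl _ (.of_adj hc')⟩, Or.inl rfl⟩
    · obtain ⟨y, hy, h⟩ := hdom _ h
      rcases y with w | i
      · exact ⟨w, Finset.mem_inter.2 ⟨hy, hFl _ (.of_adj_adj hc' h.1)⟩, Or.inr h.1⟩
      · rcases h with ⟨h, -⟩ | ⟨h, -⟩
        · exact absurd h hc'.ne'
        · exact absurd h hne.symm
  have hyz : y ≠ z := by
    rcases hya with rfl | rfl | ⟨x, rfl, h1, h2⟩ <;> rcases hzc with rfl | rfl | ⟨x', rfl, h3, h4⟩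
    · simpa using hc.ne
    · simp
    · simpa using h4.symm
    · simp
    · simp
    · simp
    · simpa using h2
    · simp
    · intro h
      obtain rfl := Sum.inl_injective h
      exact tri hc h1 h3
  have hxz : z ≠ .inl x := by
    rintro rfl
    rcases hzc with h | h | ⟨x', h, h3, h4⟩
    · obtain rfl := Sum.inl_injective h
      rcases hxc with h | h
      · exact hne h
      · exact tri hc' hc h
    · simp at h
    · obtain rfl := Sum.inl_injective h
      rcases hxc with rfl | h
      · exact tri hc hc' h3
      · exact hne (common_neighbor_unique hG h4.symm hc h3 hc' h)
  have hyx : y = .inl x := by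
    rcases hthree y hy z hz _ hx with h | h | h
    · exact absurd h hyz
    · exact h
    · exact absurd h hxz
  have hzi : z = .inr i := by
    rcases hthree y hy z hz _ hi with h | h | h
    · exact absurd h hyz
    · rw [hyx] at h
      simp at h
    · exact h
  subst hyx hzi
  have hi2 : i = 2 := by
    rcases hzc with h | h | ⟨x', h, -⟩
    · simp at h
    · exact Sum.inr_injective h
    · simp at h
  subst hi2
  -- the partner of the last subdivision vertex is a third vertex in the enlarged ball
  obtain ⟨w, hw, hw2, h⟩ := hpart _ (Finset.mem_inter.1 hi).1
  have hxa : x ≠ c ∧ ¬ G.Adj c x ∨ x = a := by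
    rcases hya with h | h | ⟨x', h, h1, h2⟩
    · exact Or.inr (Sum.inl_injective h)
    · simp at h
    · obtain rfl := Sum.inl_injective h
      exact Or.inl ⟨h2, tri hc h1⟩
  have hwF : w ∈ F ∧ w ≠ .inl x := by
    rcases w with v | j
    · have hv : v = c ∨ (G.Adj c v ∧ v ≠ a) := by
        rcases h with h | (⟨-, h⟩ | ⟨h, -⟩) | ⟨t, h, h'⟩
        · simp at h
        · simp at h
        · exact Or.inl h
        · rcases t with t | j
          · rcases h with ⟨-, h⟩ | ⟨rfl, -⟩
            · simp at h
            · exact Or.inr ⟨h'.1, nonbr h'.2⟩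
          · rcases h' with ⟨-, h'⟩ | ⟨h', -⟩
            · rcases h with h | h <;> simp at h <;> omega
            · exact Or.inl h'
      refine ⟨hFl v ?_, fun h => ?_⟩
      · rcases hv with rfl | hv
        · exact .of_adj hc
        · exact .of_adj_adj hc hv.1
      · obtain rfl := Sum.inl_injective h
        rcases hv with rfl | ⟨h1, h2⟩
        · rcases hxa with h | h
          · exact h.1 rfl
          · exact hc.ne h.symm
        · rcases hxa with h | h
          · exact h.2 h1
          · exact h2 h
    · exact ⟨hFr j, by simp⟩
  rcases hthree _ hx _ hi w (Finset.mem_inter.2 ⟨hw, hwF.1⟩) with h | h | h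
  · simp at h
  · exact hwF.2 h.symm
  · exact hw2 h.symm

/-- A nontrivial tree with a perfect code of radius two containing all support vertices has
semitotal domination multisubdivision number three. -/
theorem IsLeafyCode.msd_eq_three (hA : IsLeafyCode G A) (hG : G.IsTree)
    (hdeg : ∀ v, ∃ w, G.Adj v w) : msd G = 3 := by
  classical
  obtain ⟨v₀⟩ := hG.connected.nonempty
  obtain ⟨a, ha, -⟩ := hA.cover v₀
  obtain ⟨c, c', hc, hc', hne⟩ := hA.exists_two_neighbors hdeg ha
  have hlow := hA.two_mul_card_le hG hdeg
  have hupp := hA.le_two_mul_card hG hdeg ha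
  have hmem : 3 ∈ {k | 0 < k ∧ ∃ u v : V, G.Adj u v ∧
      semitotalDominationNumber G < semitotalDominationNumber (subdivideEdge G u v k)} := by
    refine ⟨by norm_num, a, c, hc, ?_⟩
    obtain ⟨D, hD, hDc⟩ := exists_semitotalDominating_card_eq
      (exists_adj_subdivide (p := a) (q := c) (k := 3) hdeg (by norm_num))
    rw [← hDc]
    set S := (codeFinset A).erase a with hSdef
    have hScard : S.card + 1 = (codeFinset A).card :=
      Finset.card_erase_add_one (mem_codeFinset.2 ha)
    have hS : ∀ {b}, b ∈ S ↔ b ≠ a ∧ b ∈ A := by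
      intro b
      rw [hSdef, Finset.mem_erase, mem_codeFinset]
    have h1 := two_mul_card_le_subdivide hG hdeg hA.toIsLeafyPacking (S := S) (fun b hb => by
      obtain ⟨hba, hbA⟩ := hS.1 hb
      refine ⟨hbA, ⟨hba, ?_⟩, fun d hd => ⟨?_, ?_⟩⟩
      · rintro rfl
        exact hba (hA.unique b hbA a ha b (.refl _) (.of_adj hc))
      · rintro rfl
        exact hba (hA.unique b hbA d ha b (.refl _) (.of_adj hd.symm))
      · rintro rfl
        exact hba (hA.unique b hbA a ha d (.of_adj hd) (.of_adj hc))) hD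
    have h2 := three_le_card_inter hG hc hc' hne hD
    have hdisj : Disjoint (D ∩ S.biUnion fun b => (ball2 G b).map .inl)
        (D ∩ ((ball2 G a).map .inl ∪ Finset.univ.map .inr)) := by
      rw [Finset.disjoint_left]
      intro y hy hy'
      obtain ⟨b, hb, hy⟩ := Finset.mem_biUnion.1 (Finset.mem_inter.1 hy).2
      obtain ⟨v, hv, rfl⟩ := Finset.mem_map.1 hy
      rcases Finset.mem_union.1 (Finset.mem_inter.1 hy').2 with h | h
      · obtain ⟨w, hw, h⟩ := Finset.mem_map.1 h
        obtain rfl := Sum.inl_injective h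
        exact (hS.1 hb).1 (hA.unique b (hS.1 hb).2 a ha w (mem_ball2.1 hv) (mem_ball2.1 hw))
      · simp at h
    have h3 := Finset.card_le_card (Finset.union_subset
      (Finset.inter_subset_left (s₁ := D) (s₂ := S.biUnion fun b => (ball2 G b).map .inl))
      (Finset.inter_subset_left (s₁ := D) (s₂ := (ball2 G a).map .inl ∪ Finset.univ.map .inr)))
    rw [Finset.card_union_of_disjoint hdisj] at h3
    omega
  refine le_antisymm (Nat.sInf_le hmem) (le_csInf ⟨3, hmem⟩ ?_)
  rintro k ⟨hk, u, v, huv, hlt⟩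
  by_contra hk3
  have := hA.subdivide_le_of_le_two hG huv (k := k) (by omega)
  omega

end PerfectCode

variable {S : V → Status}

section Labelings

/-! ### Labelings: the local description of the family -/

open Status

/-- The local conditions satisfied by the labeled trees of the family: the vertices of status `A`
form a perfect code of radius two, those of status `C` are at distance one and those of status `B`
at distance two from it, and only vertices of status `C` are leaves. -/
structure IsCodeLabeling (G : SimpleGraph V) (S : V → Status) : Prop where
  nbr_A : ∀ v w, S v = A → G.Adj v w → S w = C
  two_A : ∀ v, S v = A → ∃ x y, x ≠ y ∧ G.Adj v x ∧ G.Adj v y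
  exists_C : ∀ v, S v = C → ∃ a, G.Adj v a ∧ S a = A
  unique_C : ∀ v a a', S v = C → G.Adj v a → G.Adj v a' → S a = A → S a' = A → a = a'
  nbr_C : ∀ v w, S v = C → G.Adj v w → S w ≠ C
  exists_B : ∀ v, S v = B → ∃ c, G.Adj v c ∧ S c = C
  unique_B : ∀ v c c', S v = B → G.Adj v c → G.Adj v c' → S c = C → S c' = C → c = c'
  nbr_B : ∀ v, S v = B → ∃ b, G.Adj v b ∧ S b = B

lemma IsCodeLabeling.map {W : Type*} {H : SimpleGraph W} {R : W → Status}
    (h : IsCodeLabeling G S) (e : G ≃g H) (hR : ∀ v, R (e v) = S v) : IsCodeLabeling H R := by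
  have hS : ∀ w, R w = S (e.symm w) := fun w => by rw [← hR, e.apply_symm_apply]
  have hadj : ∀ v w, H.Adj v w ↔ G.Adj (e.symm v) (e.symm w) := fun v w => e.symm.map_adj_iff.symm
  have hex : ∀ {P : V → Prop}, (∃ v, P v) → ∃ w, P (e.symm w) := by
    rintro P ⟨v, hv⟩
    exact ⟨e v, by rwa [e.symm_apply_apply]⟩
  constructor <;> simp only [hS, hadj]
  · exact fun v w => h.nbr_A _ _
  · intro v hv
    obtain ⟨x, y, hxy, hx, hy⟩ := h.two_A _ hv
    exact ⟨e x, e y, fun h => hxy (e.injective h), by simpa using hx, by simpa using hy⟩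
  · exact fun v hv => hex (h.exists_C _ hv)
  · exact fun v a a' h1 h2 h3 h4 h5 => e.symm.injective (h.unique_C _ _ _ h1 h2 h3 h4 h5)
  · exact fun v w => h.nbr_C _ _
  · exact fun v hv => hex (h.exists_B _ hv)
  · exact fun v a a' h1 h2 h3 h4 h5 => e.symm.injective (h.unique_B _ _ _ h1 h2 h3 h4 h5)
  · exact fun v hv => hex (h.nbr_B _ hv)

lemma isCodeLabeling_pathGraph : IsCodeLabeling (SimpleGraph.pathGraph 3) ![C, A, C] := by
  constructor <;> simp [SimpleGraph.pathGraph_adj, Fin.forall_fin_succ, Fin.exists_fin_succ]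

lemma IsCodeLabeling.op₁ {v : V} (h : IsCodeLabeling G S) (hv : S v = A) :
    IsCodeLabeling (attachPath G v 1) (Sum.elim S ![C]) := by
  obtain ⟨h1, h2, h3, h4, h5, h6, h7, h8⟩ := h
  constructor <;> simp [Fin.forall_fin_succ, Fin.exists_fin_succ, attachPath] <;> grind

lemma IsCodeLabeling.op₂ {v : V} (h : IsCodeLabeling G S) (hv : S v = B) :
    IsCodeLabeling (attachPath G v 4) (Sum.elim S ![B, C, A, C]) := by
  obtain ⟨h1, h2, h3, h4, h5, h6, h7, h8⟩ := h
  constructor <;> simp [Fin.forall_fin_succ, Fin.exists_fin_succ, attachPath] <;> grind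

lemma IsCodeLabeling.op₃ {v : V} (h : IsCodeLabeling G S) (hv : S v = C) :
    IsCodeLabeling (attachPath G v 5) (Sum.elim S ![B, B, C, A, C]) := by
  obtain ⟨h1, h2, h3, h4, h5, h6, h7, h8⟩ := h
  constructor <;> simp [Fin.forall_fin_succ, Fin.exists_fin_succ, attachPath] <;> grind

lemma FamilyU.isCodeLabeling (h : FamilyU G S) : IsCodeLabeling G S := by
  induction h with
  | base e hS => exact isCodeLabeling_pathGraph.map e hS
  | op₁ _ v hv ih => exact ih.op₁ hv
  | op₂ _ v hv ih => exact ih.op₂ hv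
  | op₃ _ v hv ih => exact ih.op₃ hv
  | iso _ e hR ih => exact ih.map e hR

lemma IsCodeLabeling.isLeafyCode (h : IsCodeLabeling G S) : IsLeafyCode G {v | S v = A} := by
  obtain ⟨h1, h2, h3, h4, h5, h6, h7, h8⟩ := h
  refine ⟨⟨?_, ?_⟩, ?_⟩
  · intro a (ha : S a = A) a' (ha' : S a' = A) v hv hv'
    have hs : ∀ x y, G.Adj x y → G.Adj y x := fun _ _ h => h.symm
    rcases hv with hv | hv | ⟨c, hac, hcv⟩ <;> rcases hv' with hv' | hv' | ⟨c', hac', hcv'⟩ <;>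
      cases hSv : S v <;> grind
  · intro l s hls hl
    change S s = A
    cases hSl : S l
    · obtain ⟨x, y, hxy, hx, hy⟩ := h2 l hSl
      exact absurd ((hl x hx).trans (hl y hy).symm) hxy
    · obtain ⟨c, hc, hcC⟩ := h6 l hSl
      obtain ⟨b, hb, hbB⟩ := h8 l hSl
      rw [hl c hc, ← hl b hb, hbB] at hcC
      exact absurd hcC (by simp)
    · obtain ⟨a, ha, haA⟩ := h3 l hSl
      exact hl a ha ▸ haA
  · intro v
    cases hSv : S v
    · exact ⟨v, hSv, .refl _⟩
    · obtain ⟨c, hc, hcC⟩ := h6 v hSv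
      obtain ⟨a, ha, haA⟩ := h3 c hcC
      exact ⟨a, haA, .of_adj_adj ha.symm hc.symm⟩
    · obtain ⟨a, ha, haA⟩ := h3 v hSv
      exact ⟨a, haA, .of_adj ha.symm⟩

open Classical in
/-- The labeling determined by a code: status `A` on the code, `C` next to it, `B` elsewhere. -/
noncomputable def codeLabeling (G : SimpleGraph V) (K : Set V) (v : V) : Status :=
  if v ∈ K then A else if ∃ a ∈ K, G.Adj v a then C else B

lemma IsLeafyCode.isCodeLabeling {K : Set V} (hK : IsLeafyCode G K) (hG : G.IsTree)
    (hdeg : ∀ v, ∃ w, G.Adj v w) : IsCodeLabeling G (codeLabeling G K) := by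
  have hA : ∀ v, codeLabeling G K v = A ↔ v ∈ K := by
    intro v
    unfold codeLabeling
    split_ifs <;> simp_all
  have hC : ∀ v, codeLabeling G K v = C ↔ v ∉ K ∧ ∃ a ∈ K, G.Adj v a := by
    intro v
    unfold codeLabeling
    split_ifs <;> simp_all
  have hB : ∀ v, codeLabeling G K v = B ↔ v ∉ K ∧ ¬ ∃ a ∈ K, G.Adj v a := by
    intro v
    unfold codeLabeling
    split_ifs <;> simp_all
  have hindep : ∀ a ∈ K, ∀ w, G.Adj a w → w ∉ K := fun a ha w haw hw =>
    haw.ne (hK.unique a ha w hw a (.refl _) (.of_adj haw.symm))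
  -- a vertex at distance two from the code has a path to it
  have hpath : ∀ v ∉ K, (¬ ∃ a ∈ K, G.Adj v a) → ∃ a ∈ K, ∃ c, G.Adj v c ∧ G.Adj c a := by
    intro v hv hva
    obtain ⟨a, ha, rfl | h | ⟨c, h, h'⟩⟩ := hK.cover v
    · exact absurd ha hv
    · exact absurd ⟨a, ha, h.symm⟩ hva
    · exact ⟨a, ha, c, h'.symm, h.symm⟩
  have huniq : ∀ v ∉ K, ∀ c c', G.Adj v c → G.Adj v c' → (∃ a ∈ K, G.Adj c a) →
      (∃ a ∈ K, G.Adj c' a) → c = c' := by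
    rintro v hv c c' hc hc' ⟨a, ha, hca⟩ ⟨a', ha', hca'⟩
    obtain rfl := hK.unique a ha a' ha' v (.of_adj_adj hca.symm hc.symm)
      (.of_adj_adj hca'.symm hc'.symm)
    exact common_neighbor_unique hG (by rintro rfl; exact hv ha) hc hca hc' hca'
  constructor <;> simp only [hA, hB, hC, ne_eq]
  · exact fun v w hv hvw => ⟨hindep v hv w hvw, v, hv, hvw.symm⟩
  · intro v hv
    obtain ⟨c, c', hc, hc', hne⟩ := hK.exists_two_neighbors hdeg hv
    exact ⟨c, c', hne, hc, hc'⟩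
  · rintro v ⟨-, a, ha, h⟩
    exact ⟨a, h, ha⟩
  · intro v a a' _ h h' ha ha'
    exact hK.unique a ha a' ha' v (.of_adj h.symm) (.of_adj h'.symm)
  · rintro v w ⟨-, a, ha, hva⟩ hvw ⟨-, a', ha', hwa'⟩
    obtain rfl := hK.unique a ha a' ha' v (.of_adj hva.symm) (.of_adj_adj hwa'.symm hvw.symm)
    exact not_adj_of_common_neighbor hG hva.symm hwa'.symm hvw
  · rintro v ⟨hv, hva⟩
    obtain ⟨a, ha, c, hvc, hca⟩ := hpath v hv hva
    exact ⟨c, hvc, hindep a ha c hca.symm, a, ha, hca⟩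
  · rintro v c c' ⟨hv, hva⟩ hc hc' ⟨-, h⟩ ⟨-, h'⟩
    exact huniq v hv c c' hc hc' h h'
  · rintro v ⟨hv, hva⟩
    obtain ⟨a, ha, c, hvc, hca⟩ := hpath v hv hva
    by_contra hcon
    push Not at hcon
    -- otherwise `v` is a leaf with support `c`, but `c` is not in the code
    refine hindep a ha c hca.symm (hK.leaf v c hvc fun w hw => ?_)
    have hwK : w ∉ K := fun h => hva ⟨w, h, hw⟩
    have hwa := hcon w hw hwK
    exact huniq v hv w c hw hvc hwa ⟨a, ha, hca⟩

/-! ### Pruning a labeled tree -/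

/-- The path `p` is attached to the rest of `G` by the edge from `v` to its first vertex only. -/
structure IsPendantPath (G : SimpleGraph V) {k : ℕ} (v : V) (p : Fin k → V) : Prop where
  injective : Function.Injective p
  notMem : v ∉ Set.range p
  adj_iff : ∀ i w, G.Adj (p i) w ↔
    (w = v ∧ i.val = 0) ∨ ∃ j, w = p j ∧ (i.val + 1 = j.val ∨ j.val + 1 = i.val)

section Prune

variable {k : ℕ} {v : V} {p : Fin k → V}

lemma IsPendantPath.eq_of_adj (h : IsPendantPath G v p) {w x : V} (hw : w ∉ Set.range p)
    (hx : x ∈ Set.range p) (ha : G.Adj w x) : w = v ∧ ∃ i, x = p i ∧ i.val = 0 := by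
  obtain ⟨i, rfl⟩ := hx
  rcases (h.adj_iff i w).1 ha.symm with ⟨h1, h2⟩ | ⟨j, rfl, -⟩
  · exact ⟨h1, i, rfl, h2⟩
  · exact absurd ⟨j, rfl⟩ hw

/-- The graph is recovered by attaching the path to the rest. -/
noncomputable def IsPendantPath.iso (h : IsPendantPath G v p) :
    attachPath (G.induce (Set.range p)ᶜ) ⟨v, h.notMem⟩ k ≃g G where
  toEquiv := Equiv.ofBijective (Sum.elim Subtype.val p) (by
    constructor
    · rintro (⟨a, ha⟩ | i) (⟨b, hb⟩ | j) hab
      · simpa using hab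
      · exact absurd ⟨j, hab.symm⟩ ha
      · exact absurd ⟨i, hab⟩ hb
      · exact congrArg _ (h.injective hab)
    · intro x
      by_cases hx : x ∈ Set.range p
      · obtain ⟨i, rfl⟩ := hx
        exact ⟨.inr i, rfl⟩
      · exact ⟨.inl ⟨x, hx⟩, rfl⟩)
  map_rel_iff' := by
    rintro (⟨a, ha⟩ | i) (⟨b, hb⟩ | j)
    · exact Iff.rfl
    · change G.Adj a (p j) ↔ (⟨a, ha⟩ : ((Set.range p)ᶜ : Set V)) = ⟨v, h.notMem⟩ ∧ j.val = 0
      rw [G.adj_comm, h.adj_iff, Subtype.mk_eq_mk]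
      refine or_iff_left ?_
      rintro ⟨i, rfl, -⟩
      exact ha ⟨i, rfl⟩
    · change G.Adj (p i) b ↔ (⟨b, hb⟩ : ((Set.range p)ᶜ : Set V)) = ⟨v, h.notMem⟩ ∧ i.val = 0
      rw [h.adj_iff, Subtype.mk_eq_mk]
      refine or_iff_left ?_
      rintro ⟨i, rfl, -⟩
      exact hb ⟨i, rfl⟩
    · change G.Adj (p i) (p j) ↔ i.val + 1 = j.val ∨ j.val + 1 = i.val
      rw [h.adj_iff]
      constructor
      · rintro (⟨hj, -⟩ | ⟨j', hj, h'⟩)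
        · exact absurd ⟨j, hj⟩ h.notMem
        · rwa [h.injective hj]
      · exact fun h' => Or.inr ⟨j, rfl, h'⟩

lemma IsPendantPath.isTree_induce (h : IsPendantPath G v p) (hG : G.IsTree) :
    (G.induce (Set.range p)ᶜ).IsTree := by
  classical
  refine ⟨?_, hG.isAcyclic.induce _⟩
  -- contracting the path to `v` is a retraction onto the rest
  let f : V → ((Set.range p)ᶜ : Set V) := fun x =>
    if hx : x ∈ Set.range p then ⟨v, h.notMem⟩ else ⟨x, hx⟩
  have hf : ∀ x y, G.Adj x y → (G.induce (Set.range p)ᶜ).Reachable (f x) (f y) := by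
    intro x y hxy
    by_cases hx : x ∈ Set.range p <;> by_cases hy : y ∈ Set.range p
    · simp only [f, dif_pos hx, dif_pos hy]
      exact .refl _
    · obtain ⟨rfl, -⟩ := h.eq_of_adj hy hx hxy.symm
      simp only [f, dif_pos hx, dif_neg hy]
      exact .refl _
    · obtain ⟨rfl, -⟩ := h.eq_of_adj hx hy hxy
      simp only [f, dif_pos hy, dif_neg hx]
      exact .refl _
    · simp only [f, dif_neg hx, dif_neg hy]
      exact SimpleGraph.Adj.reachable hxy
  have hwalk : ∀ x y, G.Walk x y → (G.induce (Set.range p)ᶜ).Reachable (f x) (f y) := by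
    intro x y q
    induction q with
    | nil => exact .refl _
    | cons ha _ ih => exact (hf _ _ ha).trans ih
  have : Nonempty ((Set.range p)ᶜ : Set V) := ⟨⟨v, h.notMem⟩⟩
  refine ⟨fun x y => ?_⟩
  obtain ⟨q⟩ := hG.connected x.1 y.1
  have := hwalk _ _ q
  simp only [f, dif_neg x.2, dif_neg y.2] at this
  exact this

lemma IsPendantPath.isCodeLabeling_induce (h : IsPendantPath G v p) (hS : IsCodeLabeling G S)
    (hA : S v = A → ∃ x y, x ≠ y ∧ x ∉ Set.range p ∧ y ∉ Set.range p ∧ G.Adj v x ∧ G.Adj v y)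
    (hC : S v = C → ∀ i : Fin k, i.val = 0 → S (p i) ≠ A)
    (hB : S v = B → (∀ i : Fin k, i.val = 0 → S (p i) ≠ C) ∧
      ∃ b, b ∉ Set.range p ∧ G.Adj v b ∧ S b = B) :
    IsCodeLabeling (G.induce (Set.range p)ᶜ) (fun x => S x) := by
  have key : ∀ {x y}, x ∉ Set.range p → G.Adj x y → y ∉ Set.range p ∨
      (x = v ∧ ∃ i, y = p i ∧ i.val = 0) := by
    intro x y hx hxy
    by_cases hy : y ∈ Set.range p
    · exact Or.inr (h.eq_of_adj hx hy hxy)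
    · exact Or.inl hy
  refine ⟨fun x y h1 h2 => hS.nbr_A _ _ h1 h2, ?_, ?_, ?_,
    fun x y h1 h2 => hS.nbr_C _ _ h1 h2, ?_, ?_, ?_⟩
  · rintro ⟨x, hx⟩ hxA
    by_cases hxv : x = v
    · subst hxv
      obtain ⟨y, z, hyz, hy, hz, h1, h2⟩ := hA hxA
      exact ⟨⟨y, hy⟩, ⟨z, hz⟩, fun h => hyz (congrArg Subtype.val h), h1, h2⟩
    · obtain ⟨y, z, hyz, h1, h2⟩ := hS.two_A x hxA
      have hy := (key hx h1).resolve_right fun h => hxv h.1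
      have hz := (key hx h2).resolve_right fun h => hxv h.1
      exact ⟨⟨y, hy⟩, ⟨z, hz⟩, fun h => hyz (congrArg Subtype.val h), h1, h2⟩
  · rintro ⟨x, hx⟩ hxC
    obtain ⟨a, ha, haA⟩ := hS.exists_C x hxC
    rcases key hx ha with h' | ⟨rfl, i, rfl, hi⟩
    · exact ⟨⟨a, h'⟩, ha, haA⟩
    · exact absurd haA (hC hxC i hi)
  · rintro x a a' h1 h2 h3 h4 h5
    exact Subtype.ext (hS.unique_C _ _ _ h1 h2 h3 h4 h5)
  · rintro ⟨x, hx⟩ hxB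
    obtain ⟨c, hc, hcC⟩ := hS.exists_B x hxB
    rcases key hx hc with h' | ⟨rfl, i, rfl, hi⟩
    · exact ⟨⟨c, h'⟩, hc, hcC⟩
    · exact absurd hcC ((hB hxB).1 i hi)
  · rintro x a a' h1 h2 h3 h4 h5
    exact Subtype.ext (hS.unique_B _ _ _ h1 h2 h3 h4 h5)
  · rintro ⟨x, hx⟩ hxB
    by_cases hxv : x = v
    · subst hxv
      obtain ⟨b, hb, h1, h2⟩ := (hB hxB).2
      exact ⟨⟨b, hb⟩, h1, h2⟩
    · obtain ⟨b, hb, hbB⟩ := hS.nbr_B x hxB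
      exact ⟨⟨b, (key hx hb).resolve_right fun h => hxv h.1⟩, hb, hbB⟩

lemma card_compl_range_lt [Finite V] (hk : 0 < k) :
    Nat.card ((Set.range p)ᶜ : Set V) < Nat.card V := by
  have h := Set.ncard_add_ncard_compl (Set.range p)
  have h' : 0 < (Set.range p).ncard := (Set.ncard_pos (Set.toFinite _)).2 ⟨p ⟨0, hk⟩, _, rfl⟩
  rw [Nat.card_coe_set_eq]
  omega

lemma IsPendantPath.familyU (h : IsPendantPath G v p) {t : Fin k → Status}
    (hU : FamilyU (attachPath (G.induce (Set.range p)ᶜ) ⟨v, h.notMem⟩ k)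
      (Sum.elim (fun x => S x.1) t)) (ht : ∀ i, S (p i) = t i) : FamilyU G S := by
  refine hU.iso h.iso ?_
  rintro (x | i)
  · rfl
  · exact ht i

end Prune

/-- A labeled tree with three vertices is the starting point of the family. -/
lemma familyU_path {x a y : V} (hx : G.Adj x a) (hy : G.Adj a y) (hyx : y ≠ x)
    (hall : ∀ z, z = x ∨ z = a ∨ z = y) (hnot : ¬ G.Adj x y) (hxC : S x = C) (haA : S a = A)
    (hyC : S y = C) : FamilyU G S := by
  have hnot' : ¬ G.Adj y x := fun h => hnot h.symm
  refine .base ⟨Equiv.ofBijective ![x, a, y] ⟨?_, ?_⟩, ?_⟩ ?_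
  · intro i j hij
    fin_cases i <;> fin_cases j <;>
      simp [hx.ne, hx.ne', hy.ne, hy.ne', hyx, hyx.symm] at hij ⊢
  · intro z
    rcases hall z with rfl | rfl | rfl
    · exact ⟨0, rfl⟩
    · exact ⟨1, rfl⟩
    · exact ⟨2, rfl⟩
  · intro i j
    change G.Adj (![x, a, y] i) (![x, a, y] j) ↔ _
    fin_cases i <;> fin_cases j <;>
      simp [SimpleGraph.pathGraph_adj, hx, hx.symm, hy, hy.symm, hnot, hnot']
  · intro i
    change S (![x, a, y] i) = _
    fin_cases i <;> simp [hxC, haA, hyC]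

/-- A path on four vertices, whose vertices have no neighbours but those on the path and `q`. -/
lemma isPendantPath_four {q p c a l : V} (hl : ∀ w, G.Adj l w ↔ w = a)
    (ha : ∀ w, G.Adj a w ↔ w = l ∨ w = c) (hc : ∀ w, G.Adj c w ↔ w = a ∨ w = p)
    (hp : ∀ w, G.Adj p w ↔ w = c ∨ w = q) (hinj : Function.Injective ![p, c, a, l])
    (hq : q ≠ p ∧ q ≠ c ∧ q ≠ a ∧ q ≠ l) : IsPendantPath G q ![p, c, a, l] := by
  refine ⟨hinj, ?_, fun i w => ?_⟩
  · obtain ⟨h1, h2, h3, h4⟩ := hq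
    rintro ⟨i, hi⟩
    fin_cases i
    exacts [h1 hi.symm, h2 hi.symm, h3 hi.symm, h4 hi.symm]
  · fin_cases i <;> simp [Fin.exists_fin_succ, hl, ha, hc, hp]
    · exact or_comm
    · exact or_comm
    · exact or_comm

/-- A path on five vertices, whose vertices have no neighbours but those on the path and `d`. -/
lemma isPendantPath_five {d q p c a l : V} (hl : ∀ w, G.Adj l w ↔ w = a)
    (ha : ∀ w, G.Adj a w ↔ w = l ∨ w = c) (hc : ∀ w, G.Adj c w ↔ w = a ∨ w = p)
    (hp : ∀ w, G.Adj p w ↔ w = c ∨ w = q) (hq : ∀ w, G.Adj q w ↔ w = d ∨ w = p)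
    (hinj : Function.Injective ![q, p, c, a, l])
    (hd : d ≠ q ∧ d ≠ p ∧ d ≠ c ∧ d ≠ a ∧ d ≠ l) : IsPendantPath G d ![q, p, c, a, l] := by
  refine ⟨hinj, ?_, fun i w => ?_⟩
  · obtain ⟨h1, h2, h3, h4, h5⟩ := hd
    rintro ⟨i, hi⟩
    fin_cases i
    exacts [h1 hi.symm, h2 hi.symm, h3 hi.symm, h4 hi.symm, h5 hi.symm]
  · fin_cases i <;> simp [Fin.exists_fin_succ, hl, ha, hc, hp, hq]
    · exact or_comm
    · exact or_comm
    · exact or_comm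

/-- Every labeled tree satisfying the local conditions is in the family. In a tree rooted at a leaf,
take a leaf `v₀` of greatest depth and its ancestors `a`, `c`, `p`, `q`. The conditions leave no
room for other branches at `c` and `p`, so that one of the three operations can be undone at `a`, at
`q` or at the neighbour of `q` of status `C`, or else the tree is a path on three vertices. -/
lemma IsCodeLabeling.familyU [Finite V] (hS : IsCodeLabeling G S) (hG : G.IsTree) :
    FamilyU G S := by
  induction hn : Nat.card V using Nat.strong_induction_on generalizing V with
  | _ n ih =>
  subst hn
  classical
  have := Fintype.ofFinite V
  -- leaves have status `C` and their neighbours have status `A`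
  have hleaf : ∀ l s, G.Adj l s → (∀ w, G.Adj l w → w = s) → S l = C ∧ S s = A := by
    intro l s hls hl
    have hsA := hS.isLeafyCode.leaf l s hls hl
    exact ⟨hS.nbr_A s l hsA hls.symm, hsA⟩
  by_cases hP₁ : ∃ a u x y, S a = A ∧ G.Adj u a ∧ (∀ w, G.Adj u w → w = a) ∧ G.Adj a x ∧
      G.Adj a y ∧ x ≠ u ∧ y ≠ u ∧ x ≠ y
  · obtain ⟨a, u, x, y, ha, hua, hu, hx, hy, hxu, hyu, hxy⟩ := hP₁
    have hp : IsPendantPath G a ![u] := by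
      refine ⟨Function.injective_of_subsingleton _, by simpa using hua.ne', fun i w => ?_⟩
      have hi : i = 0 := Subsingleton.elim _ _
      subst hi
      simp only [Matrix.cons_val_zero, Fin.exists_fin_one]
      constructor
      · exact fun h => Or.inl ⟨hu w h, rfl⟩
      · rintro (⟨rfl, -⟩ | ⟨-, h⟩)
        · exact hua
        · simp at h
    have hL := hp.isCodeLabeling_induce hS
      (fun _ => ⟨x, y, hxy, by simpa using hxu, by simpa using hyu, hx, hy⟩)
      (by simp [ha]) (by simp [ha])
    have hU := ih _ (card_compl_range_lt (by norm_num)) hL (hp.isTree_induce hG) rfl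
    exact hp.familyU (hU.op₁ ⟨a, hp.notMem⟩ ha)
      (by simpa using hS.nbr_A a u ha hua.symm)
  have hone : ∀ {a u x y}, S a = A → G.Adj u a → (∀ w, G.Adj u w → w = a) → G.Adj a x →
      G.Adj a y → x ≠ u → y ≠ u → x = y := by
    intro a u x y h1 h2 h3 h4 h5 h6 h7
    by_contra h8
    exact hP₁ ⟨a, u, x, y, h1, h2, h3, h4, h5, h6, h7, h8⟩
  have hnbr : ∀ v, ∃ w, G.Adj v w := by
    intro v
    cases hv : S v
    · obtain ⟨x, -, -, h, -⟩ := hS.two_A v hv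
      exact ⟨x, h⟩
    · obtain ⟨x, h, -⟩ := hS.exists_B v hv
      exact ⟨x, h⟩
    · obtain ⟨x, h, -⟩ := hS.exists_C v hv
      exact ⟨x, h⟩
  have exists_leaf : ∀ r : V, ∃ l s, l ≠ r ∧ G.Adj l s ∧ (∀ w, G.Adj l w → w = s) ∧
      G.dist r l = G.dist r s + 1 ∧ ∀ w, G.dist r w ≤ G.dist r l := by
    intro r
    obtain ⟨l, -, hl⟩ := Finset.exists_max_image Finset.univ (G.dist r) ⟨r, Finset.mem_univ _⟩
    have hmax : ∀ w, G.dist r w ≤ G.dist r l := fun w => hl w (Finset.mem_univ _)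
    obtain ⟨w, hw⟩ := hnbr r
    have hlr : l ≠ r := by
      rintro rfl
      have := hmax w
      rw [SimpleGraph.dist_self, SimpleGraph.dist_eq_one_iff_adj.2 hw] at this
      omega
    obtain ⟨s, hs, hsd⟩ := exists_adj_dist_add_one hG.connected r hlr
    refine ⟨l, s, hlr, hs, fun w hw => ?_, hsd, hmax⟩
    rcases adj_dist hG r hw with h | h
    · exact closer_unique hG r hw hs h hsd
    · have := hmax w
      omega
  -- a leaf `r` as root
  obtain ⟨r, s, -, hrs, hr, -⟩ := exists_leaf hG.connected.nonempty.some
  obtain ⟨hrC, hsA⟩ := hleaf r s hrs hr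
  obtain ⟨v₀, a, hv₀r, hv₀a, hv₀, hd₀, hmax⟩ := exists_leaf r
  obtain ⟨hv₀C, haA⟩ := hleaf v₀ a hv₀a hv₀
  have har : a ≠ r := by
    rintro rfl
    rw [hrC] at haA
    simp at haA
  obtain ⟨c, hac, hd₁⟩ := exists_adj_dist_add_one hG.connected r har
  have hcC : S c = C := hS.nbr_A a c haA hac
  have hcv₀ : c ≠ v₀ := by
    rintro rfl
    omega
  have ha : ∀ x, G.Adj a x → x = v₀ ∨ x = c := by
    intro x hx
    by_cases hxv : x = v₀
    · exact Or.inl hxv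
    · exact Or.inr (hone haA hv₀a hv₀ hx hac hxv hcv₀)
  by_cases hcr : c = r
  · -- the tree is the path `v₀, a, r`
    subst hcr
    obtain rfl : a = s := hr a hac.symm
    have hall : ∀ x, x = v₀ ∨ x = a ∨ x = c := by
      intro x
      obtain ⟨q⟩ := hG.connected v₀ x
      have hind : ∀ y z, G.Walk y z → (y = v₀ ∨ y = a ∨ y = c) → (z = v₀ ∨ z = a ∨ z = c) := by
        intro y z q
        induction q with
        | nil => exact id
        | cons h _ ihq =>
          intro hy
          apply ihq
          rcases hy with rfl | rfl | rfl
          · exact Or.inr (Or.inl (hv₀ _ h))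
          · rcases ha _ h with h | h
            · exact Or.inl h
            · exact Or.inr (Or.inr h)
          · exact Or.inr (Or.inl (hr _ h))
      exact hind _ _ q (Or.inl rfl)
    exact familyU_path hv₀a hac hcv₀ hall (fun h => hac.ne' (hv₀ c h)) hv₀C haA hcC
  obtain ⟨p, hcp, hd₂⟩ := exists_adj_dist_add_one hG.connected r hcr
  have neS : ∀ {x y : V}, S x ≠ S y → x ≠ y := fun h h' => h (h' ▸ rfl)
  have nbrC : ∀ x, G.Adj c x → x = a ∨ S x = B := by
    intro x hx
    cases hxS : S x
    · exact Or.inl (hS.unique_C c x a hcC hx hac.symm hxS haA)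
    · exact Or.inr rfl
    · exact absurd hxS (hS.nbr_C c x hcC hx)
  have hpa : p ≠ a := by
    rintro rfl
    omega
  have hpB : S p = B := (nbrC p hcp).resolve_left hpa
  have hpC : ∀ x, G.Adj p x → S x = C → x = c := fun x hx hxC =>
    hS.unique_B p x c hpB hx hcp.symm hxC hcC
  have notA : ∀ {x y}, S x = B → G.Adj x y → S y ≠ A := by
    intro x y hx hxy hy
    have := hS.nbr_A y x hy hxy.symm
    rw [hx] at this
    simp at this
  have hc : ∀ x, G.Adj c x → x = a ∨ x = p := by
    intro x hx
    rcases nbrC x hx with h | hxB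
    · exact Or.inl h
    by_contra hcon
    push Not at hcon
    -- a second branch at `c` would be too deep
    obtain ⟨b, hxb, hbB⟩ := hS.nbr_B x hxB
    obtain ⟨c', hbc', hc'C⟩ := hS.exists_B b hbB
    obtain ⟨a', hca', ha'A⟩ := hS.exists_C c' hc'C
    have e1 := dist_step hG hcp.symm hx hcon.2.symm hd₂
    have e2 := dist_step hG hx hxb (neS (by rw [hcC, hbB]; simp)) e1
    have e3 := dist_step hG hxb hbc' (neS (by rw [hxB, hc'C]; simp)) e2
    have := hmax c'
    omega
  have hpr : p ≠ r := by
    rintro rfl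
    rw [hrC] at hpB
    simp at hpB
  obtain ⟨q, hpq, hd₃⟩ := exists_adj_dist_add_one hG.connected r hpr
  have hqB : S q = B := by
    cases hq : S q
    · exact absurd hq (notA hpB hpq)
    · rfl
    · obtain rfl := hpC q hpq hq
      omega
  have hp : ∀ x, G.Adj p x → x = c ∨ x = q := by
    intro x hx
    by_contra hcon
    push Not at hcon
    -- a second branch at `p` would be too deep
    have hxB : S x = B := by
      cases hxS : S x
      · exact absurd hxS (notA hpB hx)
      · rfl
      · exact absurd (hpC x hx hxS) hcon.1
    obtain ⟨c', hxc', hc'C⟩ := hS.exists_B x hxB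
    obtain ⟨a', hca', ha'A⟩ := hS.exists_C c' hc'C
    obtain ⟨y, z, hyz, hy, hz⟩ := hS.two_A a' ha'A
    obtain ⟨w, hw, hwc⟩ : ∃ w, G.Adj a' w ∧ c' ≠ w := by
      by_cases hyc : c' = y
      · exact ⟨z, hz, hyc ▸ hyz⟩
      · exact ⟨y, hy, hyc⟩
    have e1 := dist_step hG hpq.symm hx hcon.2.symm hd₃
    have e2 := dist_step hG hx hxc' (neS (by rw [hpB, hc'C]; simp)) e1
    have e3 := dist_step hG hxc' hca' (neS (by rw [hxB, ha'A]; simp)) e2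
    have e4 := dist_step hG hca' hw hwc e3
    have := hmax w
    omega
  have hv₀' : ∀ w, G.Adj v₀ w ↔ w = a := fun w => ⟨hv₀ w, by rintro rfl; exact hv₀a⟩
  have ha' : ∀ w, G.Adj a w ↔ w = v₀ ∨ w = c := fun w =>
    ⟨ha w, by rintro (rfl | rfl) <;> [exact hv₀a.symm; exact hac]⟩
  have hc' : ∀ w, G.Adj c w ↔ w = a ∨ w = p := fun w =>
    ⟨hc w, by rintro (rfl | rfl) <;> [exact hac.symm; exact hcp]⟩
  have hp' : ∀ w, G.Adj p w ↔ w = c ∨ w = q := fun w =>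
    ⟨hp w, by rintro (rfl | rfl) <;> [exact hcp.symm; exact hpq]⟩
  have hdist : ∀ {k : ℕ} {f : Fin k → V} {n : ℕ}, (∀ i, G.dist r (f i) = n + i.val) →
      Function.Injective f := by
    intro k f n hf i j hij
    have h1 := hf i
    rw [hij, hf j] at h1
    exact Fin.ext (by omega)
  by_cases hqb : ∃ b, G.Adj q b ∧ S b = B ∧ b ≠ p
  · obtain ⟨b, hqb, hbB, hbp⟩ := hqb
    have hP : IsPendantPath G q ![p, c, a, v₀] := by
      refine isPendantPath_four hv₀' ha' hc' hp' (hdist (n := G.dist r p) ?_)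
        ⟨hpq.ne', neS (by rw [hqB, hcC]; simp), neS (by rw [hqB, haA]; simp),
          neS (by rw [hqB, hv₀C]; simp)⟩
      simp only [Fin.forall_fin_succ, Matrix.cons_val_zero, Matrix.cons_val_succ]
      simp [hd₀, hd₁, hd₂]
    have hbR : b ∉ Set.range ![p, c, a, v₀] := by
      rintro ⟨i, hi⟩
      have hcb : c ≠ b := neS (by rw [hcC, hbB]; simp)
      have hab : a ≠ b := neS (by rw [haA, hbB]; simp)
      have hvb : v₀ ≠ b := neS (by rw [hv₀C, hbB]; simp)
      fin_cases i
      exacts [hbp hi.symm, hcb hi, hab hi, hvb hi]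
    have hL := hP.isCodeLabeling_induce hS (fun h => by rw [hqB] at h; simp at h)
      (fun h => by rw [hqB] at h; simp at h)
      (fun _ => ⟨fun i hi h => by
        obtain rfl : i = 0 := Fin.ext hi
        change S p = C at h
        rw [hpB] at h
        simp at h, b, hbR, hqb, hbB⟩)
    have hU := ih _ (card_compl_range_lt (by norm_num)) hL (hP.isTree_induce hG) rfl
    refine hP.familyU (hU.op₂ ⟨q, hP.notMem⟩ hqB) fun i => ?_
    fin_cases i
    exacts [hpB, hcC, haA, hv₀C]
  · push Not at hqb
    obtain ⟨d, hqd, hdC⟩ := hS.exists_B q hqB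
    have hq' : ∀ w, G.Adj q w ↔ w = d ∨ w = p := by
      intro w
      constructor
      · intro hw
        cases hwS : S w
        · exact absurd hwS (notA hqB hw)
        · exact Or.inr (hqb w hw hwS)
        · exact Or.inl (hS.unique_B q w d hqB hw hqd hwS hdC)
      · rintro (rfl | rfl)
        · exact hqd
        · exact hpq.symm
    have hqa : q ≠ a := neS (by rw [hqB, haA]; simp)
    have hP : IsPendantPath G d ![q, p, c, a, v₀] := by
      refine isPendantPath_five hv₀' ha' hc' hp' hq' (hdist (n := G.dist r q) ?_)
        ⟨hqd.ne', neS (by rw [hdC, hpB]; simp), ?_, neS (by rw [hdC, haA]; simp), ?_⟩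
      · simp only [Fin.forall_fin_succ, Matrix.cons_val_zero, Matrix.cons_val_succ]
        simp [hd₀, hd₁, hd₂, hd₃]
      · rintro rfl
        rcases hc q hqd.symm with h | h
        · exact hqa h
        · exact hpq.ne' h
      · rintro rfl
        exact hqa (hv₀ q hqd.symm)
    have hL := hP.isCodeLabeling_induce hS (fun h => by rw [hdC] at h; simp at h)
      (fun _ i hi h => by
        obtain rfl : i = 0 := Fin.ext hi
        change S q = A at h
        rw [hqB] at h
        simp at h)
      (fun h => by rw [hdC] at h; simp at h)
    have hU := ih _ (card_compl_range_lt (by norm_num)) hL (hP.isTree_induce hG) rfl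
    refine hP.familyU (hU.op₃ ⟨d, hP.notMem⟩ hdC) fun i => ?_
    fin_cases i
    exacts [hqB, hpB, hcC, haA, hv₀C]

end Labelings

end SemitotalMsd

theorem theorem2p12 {V : Type*} [Fintype V] (T : SimpleGraph V) (hT : T.IsTree)
    (hV : 3 ≤ Fintype.card V) :
    SemitotalMsd.msd T = 3 ↔
      ∃ S : V → SemitotalMsd.Status, SemitotalMsd.FamilyU T S := by
  have hdeg := SemitotalMsd.exists_adj_of_tree hT hV
  constructor
  · intro hmsd
    have hsub : ∀ p b, T.Adj p b → SemitotalMsd.semitotalDominationNumber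
        (SemitotalMsd.subdivideEdge T p b 2) ≤ SemitotalMsd.semitotalDominationNumber T := by
      intro p b hpb
      by_contra hlt
      have h2 : SemitotalMsd.msd T ≤ 2 := Nat.sInf_le ⟨by norm_num, p, b, hpb, not_le.1 hlt⟩
      omega
    have hA := SemitotalMsd.isLeafyCode_deficient hT hV hsub
    exact ⟨_, (hA.isCodeLabeling hT hdeg).familyU hT⟩
  · rintro ⟨S, hS⟩
    exact hS.isCodeLabeling.isLeafyCode.msd_eq_three hT hdeg
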